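/- Let $n\ge 0$ be an integer, let $\alpha>0$, and let $E\subseteq\mathbb R^n$ be an open set with $\lambda E\subseteq E$ for all $\lambda>0$ (for instance $E=\mathbb R^n$). Let $\{(X_t)_{t\ge 0};(\mathbb P_x)_{x\in E}\}$ be a homogeneous Markov process in $E$ with $\mathbb P_x(X_0=x)=1$ and with semigroup $P_t(x,dy)=p_t(x,y)\,dy$. Assume that the semigroup densities $p_t(x,y)$ are positive for $t>0$, $x,y\in E$, satisfy the Chapman–Kolmogorov equation $\int_E p_s(x,z)p_t(z,y)\,dz=p_{s+t}(x,y)$ for all $s,t>0$ and $x,y\in E$, and are twice differentiable as a function of $(t,x,y)\in(0,\infty)\times E\times E$. For functions $\Phi:E\times E\to\mathbb R$ and $\theta,\rho:E\to\mathbb R$ consider $$p^0_t(x,y)=t^{-\frac{n\alpha}{2}}\,\Phi\Big(\frac{x}{t^{\alpha/2}},\frac{y}{t^{\alpha/2}}\Big)\,\theta\Big(\frac{y}{t^{\alpha/2}}\Big)\exp\Big\{\rho\Big(\frac{x}{t^{\alpha/2}}\Big)+\rho\Big(\frac{y}{t^{\alpha/2}}\Big)\Big\}\qquad(t>0,\ x,y\in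 E),\tag{1}$$ and the following properties, required for all $\lambda>0$ and $x,y\in E$: 1. $\Phi(\lambda x,y)=\Phi(x,\lambda y)$; 2. $\rho(\lambda x)=\lambda^{2/\alpha}\rho(x)$; 3. $\theta(\lambda y)=\lambda^{\beta}\theta(y)$ for some constant $\beta\in\mathbb R$. Say that $p$ is an $h$-transform of $p^0$ if there are a measurable function $h$, positive on $E$, and a constant $\nu\in\mathbb R$ such that $p_t(x,y)=\frac{h(y)}{h(x)}e^{-\nu t}p^0_t(x,y)$ for all $t>0$, $x,y\in E$ (the choice $h\equiv1$, $\nu=0$ gives $p=p^0$). (a) The process $(t^\alpha X_{1/t},\,t>0)$ is a homogeneous Markov process under $\mathbb P_x$ for every $x\in E$ if and only if there are $\Phi,\theta,\rho$ with properties 1–3 such that $p$ is an $h$-transform of the function $p^0$ given by (1). (b) Suppose that $p$ is an $h$-transform of a function $p^0$ of the form (1) with properties 1–3, and that moreover $\Phi(x,y)=\Phi(y,x)$ for all $x,y\in E$. Then for every $x\in E$ the process $(t^\alpha X_{1/t},\,t>0)$ is, under $\mathbb P_x$, a homogeneous Markov process in $E$ with semigroup densities $$q^{(x)}_t(a,b)=\frac{\Phi(x,b)}{\Phi(x,a)}\,e^{t\rho(x)}\,p^0_t(a,b)\qquad(t>0,\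 a,b\in E),$$ and for all $0<s<t$ and $a,b\in E$ $$t^{-n\alpha}\,\frac{p_{1/t}\big(x,\frac{b}{t^\alpha}\big)\,p_{\frac1s-\frac1t}\big(\frac{b}{t^\alpha},\frac{a}{s^\alpha}\big)}{p_{1/s}\big(x,\frac{a}{s^\alpha}\big)}=q^{(x)}_{t-s}(a,b).$$ In particular, if $p$ itself has the form (1), then $q^{(x)}_t(a,b)=\frac{\Phi(x,b)}{\Phi(x,a)}e^{t\rho(x)}p_t(a,b)$. -/

import Mathlib

open MeasureTheory ProbabilityTheory Set

namespace TimeInversion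

/-- The sigma-algebra generated by the variables `Y u` with `u ∈ T`, `u ≤ s`. -/
abbrev past {Ω V : Type*} [MeasurableSpace V] (T : Set ℝ) (Y : ℝ → Ω → V) (s : ℝ) :
    MeasurableSpace Ω :=
  ⨆ u ∈ T ∩ Iic s, MeasurableSpace.comap (Y u) inferInstance

/-- Under `μ`, the process `(Y t, t ∈ T)` is Markov with the time-homogeneous transition
probabilities `Q r a`: for `s < t` in `T`, the conditional law of `Y t` given the past up to
time `s` is `Q (t - s) (Y s)`. -/
structure IsMarkovWith {Ω V : Type*} [MeasurableSpace Ω] [MeasurableSpace V]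
    (T : Set ℝ) (Y : ℝ → Ω → V) (μ : Measure Ω) (Q : ℝ → V → Measure V) : Prop where
  measurable : ∀ t ∈ T, Measurable (Y t)
  condProb : ∀ s ∈ T, ∀ t ∈ T, s < t → ∀ A : Set V, MeasurableSet A →
    μ⟦Y t ⁻¹' A | past T Y s⟧ =ᵐ[μ] fun ω => (Q (t - s) (Y s ω)).real A

/-- `(Y t, t ∈ T)` is a homogeneous Markov process under `μ`: it is Markov with respect to some
semigroup of Markov kernels. -/
def IsHomogeneousMarkov {Ω V : Type*} [MeasurableSpace Ω] [MeasurableSpace V]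
    (T : Set ℝ) (Y : ℝ → Ω → V) (μ : Measure Ω) : Prop :=
  ∃ Q : ℝ → Kernel V V,
    (∀ r, 0 < r → IsMarkovKernel (Q r)) ∧
    (∀ r s, 0 < r → 0 < s → Q (r + s) = Q s ∘ₖ Q r) ∧
    IsMarkovWith T Y μ (fun r a => Q r a)

/-- The time-inverted process `t ↦ t ^ α X_{1/t}`, to be used for `t > 0`. -/
noncomputable def timeInverted {Ω V : Type*} [AddCommGroup V] [Module ℝ V]
    (α : ℝ) (X : ℝ → Ω → V) (t : ℝ) (ω : Ω) : V :=
  t ^ α • X (1 / t) ω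

/-- The measure `p t x y dy` on the domain `E`. -/
noncomputable def densityMeasure {V : Type*} [MeasureSpace V]
    (E : Set V) (p : ℝ → V → V → ℝ) (t : ℝ) (x : V) : Measure V :=
  (volume.restrict E).withDensity (fun y => ENNReal.ofReal (p t x y))

/-- `p` is a family of positive semigroup densities on `E`: each `p t x` is a probability
density, and the Chapman-Kolmogorov equation holds. -/
structure IsSemigroupDensity {V : Type*} [MeasureSpace V]
    (E : Set V) (p : ℝ → V → V → ℝ) : Prop where
  pos : ∀ t, 0 < t → ∀ x ∈ E, ∀ y ∈ E, 0 < p t x y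
  mass : ∀ t, 0 < t → ∀ x ∈ E, ∫⁻ y in E, ENNReal.ofReal (p t x y) = 1
  chapman_kolmogorov : ∀ s t, 0 < s → 0 < t → ∀ x ∈ E, ∀ y ∈ E,
    ∫⁻ z in E, ENNReal.ofReal (p s x z) * ENNReal.ofReal (p t z y)
      = ENNReal.ofReal (p (s + t) x y)

/-- `(X t, t ≥ 0)` with the laws `P x`, `x ∈ E`, is a homogeneous Markov process in `E` whose
semigroup is `p t x y dy`. -/
structure IsMarkovProcess {Ω V : Type*} [MeasurableSpace Ω] [MeasureSpace V]
    (E : Set V) (X : ℝ → Ω → V) (P : V → Measure Ω) (p : ℝ → V → V → ℝ) : Prop where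
  prob : ∀ x ∈ E, IsProbabilityMeasure (P x)
  start : ∀ x ∈ E, ∀ᵐ ω ∂(P x), X 0 ω = x
  semigroup : IsSemigroupDensity E p
  markov : ∀ x ∈ E, IsMarkovWith (Ici 0) X (P x) (densityMeasure E p)

/-- `f` is twice (Fréchet) differentiable on the open set `U`. -/
def TwiceDifferentiableOn {W : Type*} [NormedAddCommGroup W] [NormedSpace ℝ W]
    (f : W → ℝ) (U : Set W) : Prop :=
  DifferentiableOn ℝ f U ∧ DifferentiableOn ℝ (fderiv ℝ f) U

/-- On `E`, `p` is the Doob `h`-transform of `p₀` with constant `ν`. -/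
structure IsHTransform {V : Type*} [MeasurableSpace V]
    (E : Set V) (h : V → ℝ) (ν : ℝ) (p₀ p : ℝ → V → V → ℝ) : Prop where
  measurable : Measurable h
  pos : ∀ x ∈ E, 0 < h x
  eq : ∀ t, 0 < t → ∀ x ∈ E, ∀ y ∈ E,
    p t x y = h y / h x * Real.exp (-ν * t) * p₀ t x y

/-- The densities `p₀` have, on `E ⊆ ℝⁿ`, the form
`t^{-nα/2} Φ(x/t^{α/2}, y/t^{α/2}) θ(y/t^{α/2}) exp(ρ(x/t^{α/2}) + ρ(y/t^{α/2}))`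
with `Φ`, `ρ`, `θ` having the three scaling properties. -/
structure HasInversionForm {n : ℕ} (E : Set (EuclideanSpace ℝ (Fin n))) (α : ℝ)
    (Φ : EuclideanSpace ℝ (Fin n) → EuclideanSpace ℝ (Fin n) → ℝ)
    (θ ρ : EuclideanSpace ℝ (Fin n) → ℝ)
    (p₀ : ℝ → EuclideanSpace ℝ (Fin n) → EuclideanSpace ℝ (Fin n) → ℝ) : Prop where
  kernel_scaling : ∀ c : ℝ, 0 < c → ∀ x ∈ E, ∀ y ∈ E, Φ (c • x) y = Φ x (c • y)
  rho_homogeneous : ∀ c : ℝ, 0 < c → ∀ x ∈ E, ρ (c • x) = c ^ (2 / α) * ρ x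
  theta_homogeneous : ∃ β : ℝ, ∀ c : ℝ, 0 < c → ∀ y ∈ E, θ (c • y) = c ^ β * θ y
  eq : ∀ t, 0 < t → ∀ x ∈ E, ∀ y ∈ E,
    p₀ t x y = t ^ (-(n * α / 2)) *
      Φ ((t ^ (α / 2))⁻¹ • x) ((t ^ (α / 2))⁻¹ • y) * θ ((t ^ (α / 2))⁻¹ • y) *
      Real.exp (ρ ((t ^ (α / 2))⁻¹ • x) + ρ ((t ^ (α / 2))⁻¹ • y))

/-- The transition density `q_{s,t}^{(x)}(a,b)` of the time-inverted process started from `x`: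
`t^{-nα} p_{1/t}(x, b/t^α) p_{1/s-1/t}(b/t^α, a/s^α) / p_{1/s}(x, a/s^α)`. -/
noncomputable def invertedDensity {n : ℕ} (α : ℝ)
    (p : ℝ → EuclideanSpace ℝ (Fin n) → EuclideanSpace ℝ (Fin n) → ℝ)
    (x : EuclideanSpace ℝ (Fin n)) (s t : ℝ) (a b : EuclideanSpace ℝ (Fin n)) : ℝ :=
  t ^ (-(n * α)) *
    (p (1 / t) x ((t ^ α)⁻¹ • b) * p (1 / s - 1 / t) ((t ^ α)⁻¹ • b) ((s ^ α)⁻¹ • a)) /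
    p (1 / s) x ((s ^ α)⁻¹ • a)

end TimeInversion

/-! Whatever `p` is, Bayes' formula and the Markov property in reversed time show that the inverted
process started from `x` is Markov with transition densities `invertedDensity α p x s t a b`
(`IsMarkovProcess.measure_inter_future`, `setLIntegral_invertedDensity`). The theorem therefore asks
when this function depends on `s` and `t` only through `t - s`. Homogeneity of the process gives
this for almost every `a` after integration in `b`, and continuity and positivity of `p` give it
pointwise (`invertedDensity_eq_of_isHomogeneousMarkov`). For densities of the stated form it is a
computation in which `h` and `ν` cancel (`invertedDensity_eq_of_form`); this settles one direction
of (a), and with the symmetry of `Φ` it gives (b).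

The converse is a functional equation for logarithms. Let `S t` be the dilation by `t ^ α` and `k t
x b = log p_{1/t}(x, S t⁻¹ b)`. In the logarithm of the inverted density (`inversionExponent`) only
two terms contain `x`, so comparing `x` with a base point `x₀` gives `k t x b = k t x₀ b + c x * t +
m x b` (`exists_slope`). Inserting this back yields two facts: up to an additive constant `c` is
homogeneous of degree two under `S` (this becomes `ρ`), and the double differences of `m` are
invariant under `(b, a) ↦ (S t⁻¹ b, S t a)`.

Hence `m` should be an invariant kernel `φ = log Φ` up to functions of one variable. The obstruction
is a 2-cocycle of the multiplicative group of positive reals. It is trivial because `p` is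
continuously differentiable (`exists_coboundary_of_cocycle`), and it does not arise when `0 ∈ E`,
since the base point is then fixed by `S`. What remains is an equation linking a function of time
and a function of space, whose solutions are a multiple of `log t` plus a multiple of `1 / t`, and a
logarithmically homogeneous function (`exists_log_linear`). These give `θ` and `ν`; the leftover
function of `x` alone is `-log h`. -/

namespace TimeInversion

/-! ### Functional equations on the line -/

/-- Cauchy's functional equation on the positive half-line. -/
theorem exists_eq_mul_of_additive_pos {f : ℝ → ℝ} (hc : ContinuousOn f (Ioi 0))
    (hadd : ∀ u v, 0 < u → 0 < v → f (u + v) = f u + f v) :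
    ∃ c, ∀ u, 0 < u → f u = c * u := by
  have hdiff : ∀ a b a' b', 0 < a → 0 < b → 0 < a' → 0 < b' → a - b = a' - b' →
      f a - f b = f a' - f b' := by
    intro a b a' b' ha hb ha' hb' h
    have h1 := hadd a b' ha hb'
    have h2 := hadd a' b ha' hb
    rw [show a + b' = a' + b by linarith] at h1
    linarith
  -- Every real `x` is a difference of two positive numbers, and by `hdiff` the difference of the
  -- values of `f` depends on `x` only. This extends `f` to an additive map of ℝ.
  let F : ℝ →+ ℝ := AddMonoidHom.mk' (fun x => f (|x| + x + 1) - f (|x| + 1)) (by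
    intro x y
    have hx := neg_abs_le x
    have hy := neg_abs_le y
    have hxy := neg_abs_le (x + y)
    have ax := abs_nonneg x
    have ay := abs_nonneg y
    have axy := abs_nonneg (x + y)
    have h1 := hadd (|x| + x + 1) (|y| + y + 1) (by linarith) (by linarith)
    have h2 := hadd (|x| + 1) (|y| + 1) (by linarith) (by linarith)
    have h3 := hdiff (|x + y| + (x + y) + 1) (|x + y| + 1)
      (|x| + x + 1 + (|y| + y + 1)) (|x| + 1 + (|y| + 1)) (by linarith) (by linarith)
      (by linarith) (by linarith) (by ring)
    linarith)
  have hF : Continuous F := by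
    refine Continuous.sub ?_ ?_
    · refine hc.comp_continuous (by fun_prop) fun x => ?_
      have hx := neg_abs_le x
      simp only [mem_Ioi]; linarith
    · refine hc.comp_continuous (by fun_prop) fun x => ?_
      have hx := abs_nonneg x
      simp only [mem_Ioi]; linarith
  refine ⟨F 1, fun u hu => ?_⟩
  have h1 : F u = u * F 1 := by
    have := (F.toRealLinearMap hF).map_smul u 1
    simpa using this
  have h2 : F u = f u := by
    change f (|u| + u + 1) - f (|u| + 1) = f u
    have hx := abs_nonneg u
    rw [show |u| + u + 1 = u + (|u| + 1) by ring, hadd u _ hu (by linarith)]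
    ring
  rw [← h2, h1, mul_comm]

/-- A continuously differentiable 2-cocycle of the additive group of reals is a coboundary. -/
theorem exists_coboundary_of_cocycle {Γ : ℝ → ℝ → ℝ}
    (hΓ : ContDiff ℝ 1 (fun z : ℝ × ℝ => Γ z.1 z.2))
    (hcoc : ∀ a b c, Γ a (b + c) + Γ b c = Γ (a + b) c + Γ a b) :
    ∃ κ : ℝ → ℝ, Continuous κ ∧ ∀ a b, Γ a b = κ a + κ b - κ (a + b) := by
  set f := fun z : ℝ × ℝ => Γ z.1 z.2 with hf
  -- Differentiating the cocycle identity in `c` at `0` gives `∂₂Γ (a, b) = j (a + b) - j b`, so a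
  -- primitive `J` of `j` determines `Γ` up to `Γ a 0`, which is constant.
  set j : ℝ → ℝ := fun a => fderiv ℝ f (a, 0) (0, 1) with hj
  have hjc : Continuous j := by
    have h1 : Continuous (fderiv ℝ f) := hΓ.continuous_fderiv one_ne_zero
    have h2 : Continuous fun a : ℝ => fderiv ℝ f (a, 0) := h1.comp (by fun_prop)
    exact h2.clm_apply continuous_const
  have hd0 : ∀ a, HasDerivAt (fun c => Γ a c) (j a) 0 := by
    intro a
    have h1 : HasFDerivAt f (fderiv ℝ f (a, 0)) (a, 0) :=
      (hΓ.differentiable one_ne_zero _).hasFDerivAt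
    have h2 : HasDerivAt (fun c : ℝ => (a, c)) ((0 : ℝ), (1 : ℝ)) 0 :=
      (hasDerivAt_const _ _).prodMk (hasDerivAt_id _)
    exact h1.comp_hasDerivAt (0 : ℝ) h2
  have hd : ∀ a b, HasDerivAt (fun c => Γ a c) (j (a + b) - j b) b := by
    intro a b
    have h1 : HasDerivAt (fun c => Γ (a + b) c + Γ a b - Γ b c) (j (a + b) - j b) 0 :=
      ((hd0 (a + b)).add_const _).sub (hd0 b)
    have h2 : (fun c => Γ (a + b) c + Γ a b - Γ b c) = fun c => Γ a (b + c) := by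
      funext c; linarith [hcoc a b c]
    rw [h2] at h1
    have h3 := HasDerivAt.comp_sub_const b b (f := fun c => Γ a (b + c)) (by simpa using h1)
    simpa using h3
  set J : ℝ → ℝ := fun u => ∫ x in (0 : ℝ)..u, j x with hJ
  have hJd : ∀ u, HasDerivAt J (j u) u := fun u =>
    intervalIntegral.integral_hasDerivAt_right (hjc.intervalIntegrable _ _)
      (hjc.stronglyMeasurableAtFilter _ _) hjc.continuousAt
  have hJ0 : J 0 = 0 := by simp [hJ]
  have key : ∀ a b, Γ a b = Γ a 0 + J (a + b) - J b - J a := by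
    intro a b
    have h1 : ∀ b, HasDerivAt (fun c => Γ a c - (J (a + c) - J c)) 0 b := by
      intro b
      have h2 : HasDerivAt (fun c => J (a + c)) (j (a + b)) b := by
        have := HasDerivAt.comp_const_add a b (hJd (a + b))
        simpa using this
      have := (hd a b).sub (h2.sub (hJd b))
      rw [sub_self] at this
      exact this
    have h3 := is_const_of_deriv_eq_zero (fun b => (h1 b).differentiableAt)
      (fun b => (h1 b).deriv) b 0
    simp only [add_zero, hJ0, sub_zero] at h3
    linarith
  have h00 : ∀ a, Γ a 0 = Γ 0 0 := by
    intro a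
    have := hcoc a 0 0
    simp only [add_zero] at this
    linarith
  have hJc : Continuous J := continuous_iff_continuousAt.2 fun u => (hJd u).continuousAt
  refine ⟨fun u => Γ 0 0 - J u, by fun_prop, fun a b => ?_⟩
  rw [key a b, h00 a]
  ring

/-- If the increments of `g` between two times depend only on their distance, then `g` is affine
in time with a slope that does not depend on the space variable. -/
theorem exists_affine_of_homogeneous_increments {E : Type*} [Nonempty E] {g : ℝ → E → ℝ}
    (hc : ∀ b, ContinuousOn (fun t => g t b) (Ioi 0))
    (hg : ∀ a b r t t', 0 < r → r < t → r < t' →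
      g t b - g (t - r) a = g t' b - g (t' - r) a) :
    ∃ c, ∀ t, 0 < t → ∀ b, g t b = g 1 b + c * (t - 1) := by
  obtain ⟨b₀⟩ := ‹Nonempty E›
  have h1 : ∀ a b s t u, 0 < s → s < t → 0 < u →
      g (t + u) b - g t b = g (s + u) a - g s a := by
    intro a b s t u hs hst hu
    have := hg a b (t - s) (t + u) t (by linarith) (by linarith) (by linarith)
    rw [show t + u - (t - s) = s + u by ring, show t - (t - s) = s by ring] at this
    linarith
  -- Both increments are compared with the increment of `g · b₀` from a common time earlier than `t`
  -- and `1`, since `h1` moves only between an earlier and a later time.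
  have h2 : ∀ b t u, 0 < t → 0 < u → g (t + u) b - g t b = g (1 + u) b₀ - g 1 b₀ := by
    intro b t u ht hu
    have hs : 0 < min t 1 / 2 := by positivity
    have hst : min t 1 / 2 < t := by linarith [min_le_left t 1]
    have hs1 : min t 1 / 2 < 1 := by linarith [min_le_right t 1]
    rw [h1 b₀ b _ t u hs hst hu, h1 b₀ b₀ _ 1 u hs hs1 hu]
  obtain ⟨c, hcu⟩ := exists_eq_mul_of_additive_pos (f := fun u => g (1 + u) b₀ - g 1 b₀)
    (((hc b₀).comp (by fun_prop) (fun u hu => by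
      simp only [mem_Ioi] at *; linarith)).sub continuousOn_const) (by
      intro u v hu hv
      have := h2 b₀ (1 + u) v (by linarith) hv
      rw [← add_assoc]
      linarith)
  refine ⟨c, fun t ht b => ?_⟩
  rcases lt_trichotomy t 1 with h | rfl | h
  · have := h2 b t (1 - t) ht (by linarith)
    rw [hcu _ (by linarith : 0 < 1 - t), show t + (1 - t) = 1 by ring] at this
    linarith
  · simp
  · have := h2 b 1 (t - 1) one_pos (by linarith)
    rw [hcu _ (by linarith : 0 < t - 1), show 1 + (t - 1) = t by ring] at this
    linarith

/-! ### Consequences of homogeneity for an abstract scaling -/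

/-- A continuous action of the multiplicative group of positive reals. -/
structure IsScaling {E : Type*} [TopologicalSpace E] (S : ℝ → E → E) : Prop where
  one : ∀ x, S 1 x = x
  mul : ∀ s t, 0 < s → 0 < t → ∀ x, S s (S t x) = S (s * t) x
  continuousOn : ContinuousOn (fun z : ℝ × E => S z.1 z.2) (Ioi 0 ×ˢ univ)

/-- The logarithm of the transition density from `a` at time `t - r` to `b` at time `t` of the
inverted process started from `x`, in terms of `k t x b = log p_{1/t} (x, S t⁻¹ b)`. -/
noncomputable def inversionExponent {E : Type*} (S : ℝ → E → E) (N : ℝ) (k : ℝ → E → E → ℝ)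
    (x a b : E) (r t : ℝ) : ℝ :=
  k t x b + k ((t - r) * t / r) (S t⁻¹ b) (S (t / r) a) - k (t - r) x a - N * Real.log t

/-- The part of `inversionExponent` that remains for `k t x b = K t b + c x * t + m x b`. -/
noncomputable def reducedExponent {E : Type*} (S : ℝ → E → E) (N : ℝ) (K : ℝ → E → ℝ)
    (c : E → ℝ) (m : E → E → ℝ) (a b : E) (r t : ℝ) : ℝ :=
  K t b - K (t - r) a + K ((t - r) * t / r) (S (t / r) a) +
    c (S t⁻¹ b) * ((t - r) * t / r) + m (S t⁻¹ b) (S (t / r) a) - N * Real.log t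

section Algebra

variable {E : Type*} {S : ℝ → E → E} {N : ℝ}

/-- The middle term of `inversionExponent` does not contain `x`. Subtracting the conditions for `x`
and `x₀` thus leaves increments of `k t x b - k t x₀ b`, to which
`exists_affine_of_homogeneous_increments` applies. -/
theorem exists_slope {k : ℝ → E → E → ℝ} (x₀ : E)
    (hk : ∀ x b, ContinuousOn (fun t => k t x b) (Ioi 0))
    (hH : ∀ x a b r t t', 0 < r → r < t → r < t' →
      inversionExponent S N k x a b r t = inversionExponent S N k x a b r t') :
    ∃ c : E → ℝ, ∀ t, 0 < t → ∀ x b,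
      k t x b = k t x₀ b + c x * t + (k 1 x b - k 1 x₀ b - c x) := by
  have : ∀ x, ∃ c, ∀ t, 0 < t → ∀ b,
      k t x b - k t x₀ b = k 1 x b - k 1 x₀ b + c * (t - 1) := by
    intro x
    have : Nonempty E := ⟨x₀⟩
    refine exists_affine_of_homogeneous_increments (g := fun t b => k t x b - k t x₀ b)
      (fun b => (hk x b).sub (hk x₀ b)) ?_
    intro a b r t t' hr ht ht'
    have h1 := hH x a b r t t' hr ht ht'
    have h2 := hH x₀ a b r t t' hr ht ht'
    simp only [inversionExponent] at h1 h2
    linarith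
  choose c hc using this
  refine ⟨c, fun t ht x b => ?_⟩
  linarith [hc x t ht b]

/-- It suffices to take `x = x₀` and to expand only the middle term: once the slope is known, the
condition at `x₀` carries all the remaining information. -/
theorem reducedExponent_eq {k : ℝ → E → E → ℝ} {x₀ : E} {c : E → ℝ} {m : E → E → ℝ}
    (hc : ∀ t, 0 < t → ∀ x b, k t x b = k t x₀ b + c x * t + m x b)
    (hH : ∀ x a b r t t', 0 < r → r < t → r < t' →
      inversionExponent S N k x a b r t = inversionExponent S N k x a b r t')
    (a b : E) (r t t' : ℝ) (hr : 0 < r) (ht : r < t) (ht' : r < t') :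
    reducedExponent S N (fun t b => k t x₀ b) c m a b r t =
      reducedExponent S N (fun t b => k t x₀ b) c m a b r t' := by
  have h := hH x₀ a b r t t' hr ht ht'
  have p1 : 0 < (t - r) * t / r := div_pos (mul_pos (by linarith) (by linarith)) hr
  have p2 : 0 < (t' - r) * t' / r := div_pos (mul_pos (by linarith) (by linarith)) hr
  simp only [inversionExponent] at h
  rw [hc _ p1, hc _ p2] at h
  simp only [reducedExponent]
  linarith

variable {K : ℝ → E → ℝ} {c ρ : E → ℝ} {m : E → E → ℝ}

/-- The double differences of `m` are invariant under opposite scalings. -/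
theorem double_difference_invariant
    (hX : ∀ a b b' t, 0 < t → K t b - K t b' - (ρ b - ρ b') / t +
        (m (S t⁻¹ b) (S t a) - m (S t⁻¹ b') (S t a)) =
      K 1 b - K 1 b' - (ρ b - ρ b') + (m b a - m b' a))
    (a a' b b' : E) {t : ℝ} (ht : 0 < t) :
    m (S t⁻¹ b) (S t a) - m (S t⁻¹ b') (S t a) - m (S t⁻¹ b) (S t a') +
      m (S t⁻¹ b') (S t a') = m b a - m b' a - m b a' + m b' a' := by
  linarith [hX a b b' t ht, hX a' b b' t ht]

variable [TopologicalSpace E]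

theorem IsScaling.inv_mul_cancel (hS : IsScaling S) {t : ℝ} (ht : 0 < t) (x : E) :
    S t⁻¹ (S t x) = x := by
  rw [hS.mul _ _ (inv_pos.2 ht) ht, inv_mul_cancel₀ ht.ne', hS.one]

theorem IsScaling.mul_inv_cancel (hS : IsScaling S) {t : ℝ} (ht : 0 < t) (x : E) :
    S t (S t⁻¹ x) = x := by
  rw [hS.mul _ _ ht (inv_pos.2 ht), mul_inv_cancel₀ ht.ne', hS.one]

/-- Differences in `b` remove every term that contains only `a`. The rest is affine in `r⁻¹`, and
comparing two values of `r` separates its two coefficients. -/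
theorem reducedExponent_space_increments (hS : IsScaling S)
    (hB : ∀ a b r t t', 0 < r → r < t → r < t' →
      reducedExponent S N K c m a b r t = reducedExponent S N K c m a b r t')
    (a b b' : E) {t : ℝ} (ht : 0 < t) :
    t ^ 2 * (c (S t⁻¹ b) - c (S t⁻¹ b')) = c b - c b' ∧
    K t b - K t b' - t * (c (S t⁻¹ b) - c (S t⁻¹ b')) +
        (m (S t⁻¹ b) (S t a) - m (S t⁻¹ b') (S t a)) =
      K 1 b - K 1 b' - (c b - c b') + (m b a - m b' a) := by
  set Y := t ^ 2 * (c (S t⁻¹ b) - c (S t⁻¹ b')) with hY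
  set X := K t b - K t b' - t * (c (S t⁻¹ b) - c (S t⁻¹ b')) +
        (m (S t⁻¹ b) (S t a) - m (S t⁻¹ b') (S t a)) with hX
  set X₁ := K 1 b - K 1 b' - (c b - c b') + (m b a - m b' a) with hX₁
  have key : ∀ r, 0 < r → r < t → r < 1 → X + Y * r⁻¹ = X₁ + (c b - c b') * r⁻¹ := by
    intro r hr hrt hr1
    -- With `S r a` in place of `a`, the factor `S (t / r)` becomes `S t`, so `m` no longer depends
    -- on `r`.
    have e1 := hB (S r a) b r t 1 hr hrt hr1
    have e2 := hB (S r a) b' r t 1 hr hrt hr1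
    simp only [reducedExponent] at e1 e2
    rw [hS.mul _ _ (div_pos ht hr) hr, hS.mul _ _ (div_pos one_pos hr) hr,
      div_mul_cancel₀ _ hr.ne', div_mul_cancel₀ _ hr.ne', inv_one] at e1 e2
    simp only [hS.one] at e1 e2
    have hrr : r * r⁻¹ = 1 := mul_inv_cancel₀ hr.ne'
    have e3 : (t - r) * t / r = t ^ 2 * r⁻¹ - t := by field_simp
    have e4 : (1 - r) * 1 / r = r⁻¹ - 1 := by field_simp
    rw [e3, e4] at e1 e2
    rw [hX, hY, hX₁]
    linear_combination e1 - e2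
  have hr : 0 < min t 1 / 2 := by positivity
  have hrt : min t 1 / 2 < t := by linarith [min_le_left t 1]
  have hr1 : min t 1 / 2 < 1 := by linarith [min_le_right t 1]
  set r := min t 1 / 2
  have k1 := key r hr hrt hr1
  have k2 := key (r / 2) (by linarith) (by linarith) (by linarith)
  have e : (r / 2)⁻¹ = 2 * r⁻¹ := by field_simp
  rw [e] at k2
  have hri : 0 < r⁻¹ := inv_pos.2 hr
  have hYc : Y = c b - c b' := by
    have : (Y - (c b - c b')) * r⁻¹ = 0 := by linear_combination k2 - k1
    rcases mul_eq_zero.1 this with h | h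
    · linarith
    · exact absurd h hri.ne'
  exact ⟨hYc, by rw [hYc] at k1; linarith⟩

/-- A function whose differences are homogeneous of degree two is homogeneous up to a constant. -/
theorem exists_homogeneous_of_sub (hS : IsScaling S) (x₀ : E)
    (hc : ∀ b b' t, 0 < t → t ^ 2 * (c (S t⁻¹ b) - c (S t⁻¹ b')) = c b - c b') :
    ∃ k₀, ∀ t, 0 < t → ∀ b, c (S t b) - k₀ = t ^ 2 * (c b - k₀) := by
  have h1 : ∀ t, 0 < t → ∀ b b', c (S t b) - t ^ 2 * c b = c (S t b') - t ^ 2 * c b' := by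
    intro t ht b b'
    have := hc (S t b) (S t b') t ht
    rw [hS.inv_mul_cancel ht, hS.inv_mul_cancel ht] at this
    linarith
  -- The defect `c (S t x) - t² c x` does not depend on `x`. Since `S 2` and `S t` commute, it is
  -- proportional to `1 - t²`; the value at `t = 2`, where `1 - t² = -3`, fixes the constant.
  have h2 : ∀ t, 0 < t → (c (S t x₀) - t ^ 2 * c x₀) * (1 - 2 ^ 2) =
      (c (S 2 x₀) - 2 ^ 2 * c x₀) * (1 - t ^ 2) := by
    intro t ht
    have e1 := h1 t ht (S 2 x₀) x₀
    have e2 := h1 2 two_pos (S t x₀) x₀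
    rw [hS.mul _ _ ht two_pos] at e1
    rw [hS.mul _ _ two_pos ht, mul_comm] at e2
    linear_combination e2 - e1
  refine ⟨-(c (S 2 x₀) - 2 ^ 2 * c x₀) / 3, fun t ht b => ?_⟩
  have e1 := h1 t ht b x₀
  have e2 := h2 t ht
  linear_combination e1 - e2 / 3

/-- The differences of `K` in the space variable, expressed by `m`. -/
theorem spatial_increments_eq (hS : IsScaling S) {x₀ : E} (hm : ∀ b, m x₀ b = 0)
    (hB : ∀ a b r t t', 0 < r → r < t → r < t' →
      reducedExponent S N K c m a b r t = reducedExponent S N K c m a b r t')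
    (hρ : ∀ t, 0 < t → ∀ b, ρ (S t b) = t ^ 2 * ρ b)
    (hX : ∀ a b b' t, 0 < t → K t b - K t b' - (ρ b - ρ b') / t +
        (m (S t⁻¹ b) (S t a) - m (S t⁻¹ b') (S t a)) =
      K 1 b - K 1 b' - (ρ b - ρ b') + (m b a - m b' a))
    (y y' : E) {t : ℝ} (ht : 0 < t) :
    K t (S t y) - K t (S t y') = t * (ρ y - ρ y') + ((K 1 y - ρ y) - (K 1 y' - ρ y')) +
      (m (S t x₀) y - m (S t x₀) y') := by
  set e := x₀
  set w : E → ℝ := fun b => K 1 b - ρ b + m b e with hw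
  have hD := fun a a' b b' t (ht : 0 < t) => double_difference_invariant hX a a' b b' ht
  have hK : ∀ b b' t, 0 < t → K t b - K t b' = (ρ b - ρ b') / t -
      (m (S t⁻¹ b) (S t e) - m (S t⁻¹ b') (S t e)) + (w b - w b') := by
    intro b b' t ht
    have := hX e b b' t ht
    simp only [hw]
    linarith
  -- Differences in `a`, with those of `K` replaced by `m` and `w`. The last bracket depends on `t`
  -- only through `t / r`, apart from `S t⁻¹ b`.
  have h1 : ∀ a a' b r t, 0 < r → r < t →
      reducedExponent S N K c m a b r t - reducedExponent S N K c m a' b r t =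
      (ρ a - ρ a') / r + (m a e - m a' e) - (w a - w a') +
      (-(m a (S (t / r) e) - m a' (S (t / r) e)) + (w (S (t / r) a) - w (S (t / r) a')) +
        (m (S t⁻¹ b) (S (t / r) a) - m (S t⁻¹ b) (S (t / r) a'))) := by
    intro a a' b r t hr hrt
    have ht : 0 < t := hr.trans hrt
    have hs : 0 < t - r := by linarith
    have hq : 0 < t / r := div_pos ht hr
    have hp : 0 < (t - r) * t / r := div_pos (mul_pos hs ht) hr
    have e1 := hK a a' (t - r) hs
    have e2 := hK (S (t / r) a) (S (t / r) a') _ hp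
    rw [hS.mul _ _ (inv_pos.2 hp) hq, hS.mul _ _ (inv_pos.2 hp) hq, hρ _ hq, hρ _ hq,
      show ((t - r) * t / r)⁻¹ * (t / r) = (t - r)⁻¹ by field_simp,
      show (t - r) * t / r = (t - r) * (t / r) by ring, ← hS.mul _ _ hs hq] at e2
    have e3 := hD e (S (t / r) e) a a' _ hs
    have e4 : ((t / r) ^ 2 * ρ a - (t / r) ^ 2 * ρ a') / ((t - r) * (t / r)) -
        (ρ a - ρ a') / (t - r) = (ρ a - ρ a') / r := by
      field_simp
    simp only [reducedExponent]
    rw [show (t - r) * t / r = (t - r) * (t / r) by ring]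
    linarith
  have h2 : ∀ a a' b r v v', 0 < r → 1 < v → 1 < v' →
      -(m a (S v e) - m a' (S v e)) + (w (S v a) - w (S v a')) +
        (m (S (r * v)⁻¹ b) (S v a) - m (S (r * v)⁻¹ b) (S v a')) =
      -(m a (S v' e) - m a' (S v' e)) + (w (S v' a) - w (S v' a')) +
        (m (S (r * v')⁻¹ b) (S v' a) - m (S (r * v')⁻¹ b) (S v' a')) := by
    intro a a' b r v v' hr hv hv'
    have hv1 : r < r * v := by nlinarith
    have hv2 : r < r * v' := by nlinarith
    have e1 := h1 a a' b r (r * v) hr hv1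
    have e2 := h1 a a' b r (r * v') hr hv2
    rw [mul_div_cancel_left₀ _ hr.ne'] at e1 e2
    have e3 := hB a b r _ _ hr hv1 hv2
    have e4 := hB a' b r _ _ hr hv1 hv2
    linarith
  -- The restriction `t > r` allows only `v > 1`. Replacing `a` by `S q a` with a small `q` and
  -- correcting by the invariance of double differences gives all `v > 0`.
  have h3 : ∀ a a' b r v v', 0 < r → 0 < v → 0 < v' →
      -(m a (S v e) - m a' (S v e)) + (w (S v a) - w (S v a')) +
        (m (S (r * v)⁻¹ b) (S v a) - m (S (r * v)⁻¹ b) (S v a')) =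
      -(m a (S v' e) - m a' (S v' e)) + (w (S v' a) - w (S v' a')) +
        (m (S (r * v')⁻¹ b) (S v' a) - m (S (r * v')⁻¹ b) (S v' a')) := by
    intro a a' b r v v' hr hv hv'
    obtain ⟨q, hq, hqv, hqv'⟩ : ∃ q : ℝ, 0 < q ∧ q < v ∧ q < v' := by
      refine ⟨min v v' / 2, by positivity, ?_, ?_⟩
      · linarith [min_le_left v v', lt_min hv hv']
      · linarith [min_le_right v v', lt_min hv hv']
    have := h2 (S q a) (S q a') b (r * q) (v / q) (v' / q) (by positivity)
      ((one_lt_div hq).2 hqv) ((one_lt_div hq).2 hqv')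
    rw [hS.mul _ _ (div_pos hv hq) hq, hS.mul _ _ (div_pos hv hq) hq,
      hS.mul _ _ (div_pos hv' hq) hq, hS.mul _ _ (div_pos hv' hq) hq,
      div_mul_cancel₀ _ hq.ne', div_mul_cancel₀ _ hq.ne',
      show r * q * (v / q) = r * v by field_simp,
      show r * q * (v' / q) = r * v' by field_simp] at this
    have e1 := hD (S v e) (S v' e) a a' q⁻¹ (inv_pos.2 hq)
    rw [inv_inv, hS.mul _ _ (inv_pos.2 hq) hv, hS.mul _ _ (inv_pos.2 hq) hv',
      show q⁻¹ * v = v / q by field_simp, show q⁻¹ * v' = v' / q by field_simp] at e1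
    linarith
  -- With `r = t⁻¹` and `b = e`, the point `S (r * v)⁻¹ b` is the base point for `v = t`, where `m`
  -- vanishes, and `S t e` for `v = 1`.
  have h4 := h3 y y' e t⁻¹ t 1 (inv_pos.2 ht) ht one_pos
  rw [inv_mul_cancel₀ ht.ne', mul_one, inv_inv, inv_one] at h4
  simp only [hS.one, e, hm] at h4
  have h5 := hK (S t y) (S t y') t ht
  rw [hρ t ht, hρ t ht, hS.inv_mul_cancel ht, hS.inv_mul_cancel ht] at h5
  have e5 : (t ^ 2 * ρ y - t ^ 2 * ρ y') / t = t * (ρ y - ρ y') := by field_simp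
  rw [e5] at h5
  simp only [hw, e] at h4 h5
  linarith

end Algebra

/-! ### Splitting off the invariant kernel and solving for the time part -/

section Decomposition

variable {E : Type*} [TopologicalSpace E] {S : ℝ → E → E} {N : ℝ}

theorem IsScaling.continuous_comp (hS : IsScaling S) {X : Type*} [TopologicalSpace X]
    {f : X → ℝ} {g : X → E} (hf : Continuous f) (hg : Continuous g) (hpos : ∀ x, 0 < f x) :
    Continuous fun x => S (f x) (g x) :=
  hS.continuousOn.comp_continuous (hf.prodMk hg) fun x => ⟨hpos x, mem_univ _⟩

/-- One double difference with base point `x₀`. The bracket on the right measures how far `m` is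
from being invariant, and it does not depend on `y`. -/
theorem cross_term (hS : IsScaling S) {m : E → E → ℝ} {x₀ : E} (hm : ∀ b, m x₀ b = 0)
    (hD : ∀ a a' b b' t, 0 < t → m (S t⁻¹ b) (S t a) - m (S t⁻¹ b') (S t a) -
      m (S t⁻¹ b) (S t a') + m (S t⁻¹ b') (S t a') = m b a - m b' a - m b a' + m b' a')
    (x y : E) {t : ℝ} (ht : 0 < t) :
    m x (S t y) + m (S t x₀) y =
      m (S t x) y + (m x (S t x₀) + m (S t x₀) x₀ - m (S t x) x₀) := by
  have := hD y x₀ (S t x) (S t x₀) t ht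
  rw [hS.inv_mul_cancel ht, hS.inv_mul_cancel ht, hm, hm] at this
  linarith

/-- Separation of the invariant part of `m` when the base point is fixed by the scaling. -/
theorem exists_invariant_of_fixed_point (hS : IsScaling S) {m : E → E → ℝ} {x₀ : E}
    (hmc : Continuous fun z : E × E => m z.1 z.2) (hm : ∀ b, m x₀ b = 0)
    (hD : ∀ a a' b b' t, 0 < t → m (S t⁻¹ b) (S t a) - m (S t⁻¹ b') (S t a) -
      m (S t⁻¹ b) (S t a') + m (S t⁻¹ b') (S t a') = m b a - m b' a - m b a' + m b' a')
    (hx₀ : ∀ t, 0 < t → S t x₀ = x₀) :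
    ∃ (φ : E → E → ℝ) (A B : E → ℝ) (d : ℝ → ℝ),
      (∀ t, 0 < t → ∀ x y, φ (S t x) y = φ x (S t y)) ∧
      Continuous A ∧ Continuous B ∧ ContinuousOn d (Ioi 0) ∧
      ∀ t, 0 < t → ∀ x y, m x (S t y) + m (S t x₀) y = φ x (S t y) + A x + B y + d t := by
  refine ⟨fun x y => m x y - m x x₀, fun x => m x x₀, 0, 0, ?_, ?_, continuous_const,
    continuousOn_const, ?_⟩
  · intro t ht x y
    have := cross_term hS hm hD x y ht
    rw [hx₀ t ht, hm, hm] at this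
    linarith
  · exact hmc.comp (continuous_id.prodMk continuous_const)
  · intro t ht x y
    rw [hx₀ t ht, hm]
    simp

/-- Separation of the invariant part of `m` in the presence of a gauge of degree one. -/
theorem exists_invariant_of_gauge (hS : IsScaling S) {m : E → E → ℝ} {x₀ : E}
    (hmc : Continuous fun z : E × E => m z.1 z.2) (hm : ∀ b, m x₀ b = 0)
    (hD : ∀ a a' b b' t, 0 < t → m (S t⁻¹ b) (S t a) - m (S t⁻¹ b') (S t a) -
      m (S t⁻¹ b) (S t a') + m (S t⁻¹ b') (S t a') = m b a - m b' a - m b a' + m b' a')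
    (hC : ContDiff ℝ 1 fun z : ℝ × ℝ => m (S (Real.exp z.1) x₀) (S (Real.exp z.2) x₀))
    {σ : E → ℝ} (hσc : Continuous σ) (hσ : ∀ x, 0 < σ x)
    (hσS : ∀ t, 0 < t → ∀ x, σ (S t x) = t * σ x) :
    ∃ (φ : E → E → ℝ) (A B : E → ℝ) (d : ℝ → ℝ),
      (∀ t, 0 < t → ∀ x y, φ (S t x) y = φ x (S t y)) ∧
      Continuous A ∧ Continuous B ∧ ContinuousOn d (Ioi 0) ∧
      ∀ t, 0 < t → ∀ x y, m x (S t y) + m (S t x₀) y = φ x (S t y) + A x + B y + d t := by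
  set G : ℝ → E → ℝ := fun t x => m x (S t x₀) + m (S t x₀) x₀ - m (S t x) x₀ with hG
  have hcross : ∀ t, 0 < t → ∀ x y, m x (S t y) + m (S t x₀) y = m (S t x) y + G t x :=
    fun t ht x y => cross_term hS hm hD x y ht
  -- The defect along the orbit of `x₀`. Composing two scalings in two ways makes it a
  -- multiplicative 2-cocycle, a coboundary in logarithmic coordinates.
  set Γ : ℝ → ℝ → ℝ := fun v s => G v (S s x₀) with hΓ
  have hΓy : ∀ v s, 0 < v → 0 < s → ∀ y,
      m (S s x₀) (S v y) + m (S v x₀) y = m (S (v * s) x₀) y + Γ v s := by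
    intro v s hv hs y
    rw [hcross v hv, hS.mul _ _ hv hs]
  obtain ⟨κ₀, hκ₀c, hκ₀⟩ : ∃ κ : ℝ → ℝ, Continuous κ ∧ ∀ a b,
      Γ (Real.exp a) (Real.exp b) = κ a + κ b - κ (a + b) := by
    refine exists_coboundary_of_cocycle (Γ := fun a b => Γ (Real.exp a) (Real.exp b)) ?_ ?_
    · have e : (fun z : ℝ × ℝ => Γ (Real.exp z.1) (Real.exp z.2)) = fun z : ℝ × ℝ =>
          m (S (Real.exp z.2) x₀) (S (Real.exp z.1) x₀) +
          m (S (Real.exp z.1) x₀) (S (Real.exp 0) x₀) -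
          m (S (Real.exp (z.1 + z.2)) x₀) (S (Real.exp 0) x₀) := by
        funext z
        have := hΓy _ _ (Real.exp_pos z.1) (Real.exp_pos z.2) x₀
        rw [Real.exp_zero, hS.one, Real.exp_add]
        linarith
      rw [e]
      refine ((hC.comp (g := fun z : ℝ × ℝ => m (S (Real.exp z.1) x₀) (S (Real.exp z.2) x₀))
        (f := fun z : ℝ × ℝ => (z.2, z.1)) (by fun_prop)).add
        (hC.comp (g := fun z : ℝ × ℝ => m (S (Real.exp z.1) x₀) (S (Real.exp z.2) x₀))
        (f := fun z : ℝ × ℝ => (z.1, 0)) (by fun_prop))).sub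
        (hC.comp (g := fun z : ℝ × ℝ => m (S (Real.exp z.1) x₀) (S (Real.exp z.2) x₀))
        (f := fun z : ℝ × ℝ => (z.1 + z.2, 0)) (by fun_prop))
    · intro a b c
      have pa := Real.exp_pos a
      have pb := Real.exp_pos b
      have pc := Real.exp_pos c
      simp only [Real.exp_add]
      have e1 := hΓy _ _ pa (mul_pos pb pc) x₀
      have e2 := hΓy _ _ pb pc (S (Real.exp a) x₀)
      have e3 := hΓy _ _ (mul_pos pa pb) pc x₀
      have e4 := hΓy _ _ pa pb x₀
      rw [hS.mul _ _ pb pa, mul_comm (Real.exp b) (Real.exp a)] at e2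
      rw [mul_assoc] at e3
      linarith
  set κ : ℝ → ℝ := fun t => κ₀ (Real.log t) with hκ
  have hκΓ : ∀ v s, 0 < v → 0 < s → Γ v s = κ v + κ s - κ (v * s) := by
    intro v s hv hs
    have := hκ₀ (Real.log v) (Real.log s)
    rwa [Real.exp_log hv, Real.exp_log hs, ← Real.log_mul hv.ne' hs.ne'] at this
  have hκc : ContinuousOn κ (Ioi 0) :=
    hκ₀c.comp_continuousOn (Real.continuousOn_log.mono fun t (ht : 0 < t) => ht.ne')
  have hκσ : Continuous fun x => κ (σ x) := hκc.comp_continuous hσc hσ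
  -- The projection onto the section `σ = 1`, constant along orbits.
  set u : E → E := fun x => S (σ x)⁻¹ x with hu
  have huc : Continuous u := hS.continuous_comp (hσc.inv₀ fun x => (hσ x).ne') continuous_id
    fun x => inv_pos.2 (hσ x)
  have hSu : ∀ x, S (σ x) (u x) = x := fun x => hS.mul_inv_cancel (hσ x) x
  have huS : ∀ t, 0 < t → ∀ x, u (S t x) = u x := by
    intro t ht x
    simp only [hu]
    rw [hσS t ht, hS.mul _ _ (inv_pos.2 (mul_pos ht (hσ x))) ht]
    congr 1
    field_simp
  have hSσ : Continuous fun x => S (σ x) x₀ := hS.continuous_comp hσc continuous_const hσ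
  -- Moving `x = S (σ x) (u x)` and then `y = S (σ y) (u y)` through the cross identity writes `m x
  -- y` as the first two terms of `φ`, functions of one variable, and `Γ (σ y) (σ x)`. Of the
  -- coboundary only `-κ (σ x * σ y)` enters `φ`; it is invariant, as is `S (σ x) y` under moving a
  -- scaling from `x` to `y`.
  refine ⟨fun x y => m (u x) (S (σ x) y) + m (S (σ x * σ y) x₀) (u y) - κ (σ x * σ y),
    fun x => -G (σ x) (u x) + κ (σ x), fun y => -m (S (σ y) x₀) (u y) + κ (σ y), κ,
    ?_, ?_, ?_, hκc, ?_⟩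
  · intro t ht x y
    simp only [hσS t ht, huS t ht]
    rw [hS.mul _ _ (hσ x) ht, mul_comm t (σ x), mul_assoc]
  · refine Continuous.add ?_ hκσ
    simp only [hG, hSu]
    refine Continuous.neg (((hmc.comp (huc.prodMk hSσ)).add
      (hmc.comp (hSσ.prodMk continuous_const))).sub
      (hmc.comp (continuous_id.prodMk continuous_const)))
  · exact (hmc.comp (hSσ.prodMk huc)).neg.add hκσ
  · intro t ht x y
    have px := hσ x
    have py := hσ y
    have e1 := hcross (σ x) px (u x) (S t y)
    rw [hSu] at e1
    have e2 := hΓy t (σ x) ht px y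
    have e3 := hΓy (σ y) (t * σ x) py (mul_pos ht px) (u y)
    rw [hSu] at e3
    have e4 := hκΓ t (σ x) ht px
    have e5 := hκΓ (σ y) (t * σ x) py (mul_pos ht px)
    simp only [hσS t ht, huS t ht]
    rw [show σ x * (t * σ y) = σ y * (t * σ x) by ring]
    linarith

/-- The functional equation satisfied by the time part and by the potential part. -/
theorem exists_log_linear {T : E → ℝ} {d : ℝ → ℝ} (hS : IsScaling S) (x₀ : E)
    (hT : Continuous T) (hd : ContinuousOn d (Ioi 0))
    (h : ∀ b r t t', 0 < r → r < t → r < t' →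
      T (S t⁻¹ b) + d t + d ((t - r) * t / r) - d (t - r) - N * Real.log t =
      T (S t'⁻¹ b) + d t' + d ((t' - r) * t' / r) - d (t' - r) - N * Real.log t') :
    ∃ β ν w : ℝ, (∀ t, 0 < t → ∀ y, T (S t y) = T y + β * Real.log t) ∧
      ∀ t, 0 < t → d t = (N + β) / 2 * Real.log t - ν / t + w := by
  have h1 : ∀ b b' t, 0 < t → T (S t b) - T (S t b') = T b - T b' := by
    intro b b' t ht
    have hr : 0 < min t⁻¹ 1 / 2 := by positivity
    have hrt : min t⁻¹ 1 / 2 < t⁻¹ := by linarith [min_le_left t⁻¹ 1]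
    have hr1 : min t⁻¹ 1 / 2 < 1 := by linarith [min_le_right t⁻¹ 1]
    have e1 := h b _ _ _ hr hrt hr1
    have e2 := h b' _ _ _ hr hrt hr1
    rw [inv_inv, inv_one, hS.one] at e1 e2
    linarith
  obtain ⟨β, hβ⟩ : ∃ β : ℝ, ∀ z, T (S (Real.exp z) x₀) - T x₀ = z * β := by
    let F : ℝ →+ ℝ := AddMonoidHom.mk' (fun z => T (S (Real.exp z) x₀) - T x₀) (by
      intro a b
      have := h1 (S (Real.exp b) x₀) x₀ (Real.exp a) (Real.exp_pos a)
      rw [hS.mul _ _ (Real.exp_pos _) (Real.exp_pos _), ← Real.exp_add] at this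
      linarith)
    have hF : Continuous F :=
      (hT.comp (hS.continuous_comp Real.continuous_exp continuous_const Real.exp_pos)).sub
        continuous_const
    refine ⟨F 1, fun z => ?_⟩
    have : F z = z * F 1 := by simpa using (F.toRealLinearMap hF).map_smul z 1
    exact this
  have hTβ : ∀ t, 0 < t → ∀ y, T (S t y) = T y + β * Real.log t := by
    intro t ht y
    have e1 := hβ (Real.log t)
    rw [Real.exp_log ht] at e1
    linarith [h1 y x₀ t ht]
  -- In the inverse times `p = 1 / t`, `p + q = 1 / (t - r)`, the argument `(t - r) * t / r` is `1 /
  -- q`, so the equation takes Cauchy's form with a right-hand side depending on `r = q / (p * (p +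
  -- q))` only.
  set D : ℝ → ℝ := fun p => d p⁻¹ + (N + β) / 2 * Real.log p with hD
  set W : ℝ → ℝ := fun r => d (2 * r) + d (2 * r) - d r - (N + β) * Real.log (2 * r) +
    (N + β) / 2 * Real.log r with hW
  have h2 : ∀ p q, 0 < p → 0 < q → D p + D q - D (p + q) = W (q / (p * (p + q))) := by
    intro p q hp hq
    have hpq : 0 < p + q := by linarith
    set r := q / (p * (p + q)) with hr
    have hr0 : 0 < r := by positivity
    have et : p⁻¹ - r = (p + q)⁻¹ := by rw [hr]; field_simp; ring
    have hrt : r < p⁻¹ := by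
      have : 0 < (p + q)⁻¹ := by positivity
      linarith
    -- At `t' = 2 * r` all arguments of `d` are `r` or `2 * r`, so this side becomes the function
    -- `W` of `r`.
    have e1 := h x₀ r p⁻¹ (2 * r) hr0 hrt (by linarith)
    have eq : (p⁻¹ - r) * p⁻¹ / r = q⁻¹ := by rw [et, hr]; field_simp
    have e2r : (2 * r - r) * (2 * r) / r = 2 * r := by field_simp; ring
    rw [eq, et, e2r, show 2 * r - r = r by ring, hTβ _ (by positivity), hTβ _ (by positivity),
      inv_inv, Real.log_inv, Real.log_inv] at e1
    have elog : Real.log r = Real.log q - (Real.log p + Real.log (p + q)) := by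
      rw [hr, Real.log_div hq.ne' (by positivity), Real.log_mul hp.ne' hpq.ne']
    simp only [hD, hW]
    rw [elog]
    linarith
  -- The left side of `h2` is symmetric in `p` and `q` but the argument of `W` is not; a pair for
  -- which the two arguments are `r` and `1` forces `W` to be constant.
  have hWc : ∀ r, 0 < r → W r = W 1 := by
    intro r hr
    have hs : 0 < Real.sqrt r := Real.sqrt_pos.2 hr
    have hss : Real.sqrt r * Real.sqrt r = r := Real.mul_self_sqrt hr.le
    set z := Real.sqrt r
    -- `p + q = 1 / z` and `q / p = z`
    have hp : 0 < 1 / (z * (1 + z)) := by positivity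
    have hq : 0 < 1 / (1 + z) := by positivity
    have e1 := h2 _ _ hp hq
    have e2 := h2 _ _ hq hp
    have f1 : 1 / (1 + z) / (1 / (z * (1 + z)) * (1 / (z * (1 + z)) + 1 / (1 + z))) = r := by
      rw [← hss]; field_simp
    have f2 : 1 / (z * (1 + z)) / (1 / (1 + z) * (1 / (1 + z) + 1 / (z * (1 + z)))) = 1 := by
      field_simp; ring
    rw [f1] at e1
    rw [f2, add_comm (1 / (1 + z)) (1 / (z * (1 + z)))] at e2
    linarith
  obtain ⟨c, hc⟩ := exists_eq_mul_of_additive_pos (f := fun p => D p - W 1) (by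
    refine ContinuousOn.sub (ContinuousOn.add ?_ ?_) continuousOn_const
    · exact hd.comp (continuousOn_inv₀.mono fun t (ht : 0 < t) => ht.ne')
        fun t (ht : 0 < t) => inv_pos.2 ht
    · exact continuousOn_const.mul (Real.continuousOn_log.mono fun t (ht : 0 < t) => ht.ne')) (by
    intro p q hp hq
    have := h2 p q hp hq
    rw [hWc _ (by positivity)] at this
    linarith)
  refine ⟨β, -c, W 1, hTβ, fun t ht => ?_⟩
  have := hc t⁻¹ (inv_pos.2 ht)
  simp only [hD, inv_inv, Real.log_inv] at this
  rw [show -c / t = -(c * t⁻¹) by rw [neg_div, div_eq_mul_inv]]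
  linarith

/-- The general form of `k` when the inversion exponent depends on the time increment only. -/
theorem exists_inversion_form (hS : IsScaling S) {k : ℝ → E → E → ℝ}
    (hk : ContinuousOn (fun z : ℝ × E × E => k z.1 z.2.1 z.2.2) (Ioi 0 ×ˢ univ))
    (hH : ∀ x a b r t t', 0 < r → r < t → r < t' →
      inversionExponent S N k x a b r t = inversionExponent S N k x a b r t')
    (x₀ : E)
    (hC : ∀ t, 0 < t → ContDiff ℝ 1 fun z : ℝ × ℝ =>
      k t (S (Real.exp z.1) x₀) (S (Real.exp z.2) x₀))
    (hx₀ : (∀ t, 0 < t → S t x₀ = x₀) ∨ ∃ σ : E → ℝ, Continuous σ ∧ (∀ x, 0 < σ x) ∧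
      ∀ t, 0 < t → ∀ x, σ (S t x) = t * σ x) :
    ∃ (φ : E → E → ℝ) (ρ T H : E → ℝ) (β ν : ℝ),
      (∀ t, 0 < t → ∀ x y, φ (S t x) y = φ x (S t y)) ∧
      (∀ t, 0 < t → ∀ x, ρ (S t x) = t ^ 2 * ρ x) ∧
      (∀ t, 0 < t → ∀ y, T (S t y) = T y + β * Real.log t) ∧ Continuous H ∧
      ∀ t, 0 < t → ∀ x y, k t x (S t y) = t * (ρ x + ρ y) + φ x (S t y) + T y + (H y - H x) -
        ν / t + (N + β) / 2 * Real.log t := by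
  have hkc : ∀ {X : Type _} [TopologicalSpace X] (t : ℝ) (f g : X → E), 0 < t →
      Continuous f → Continuous g → Continuous fun x => k t (f x) (g x) := by
    intro X _ t f g ht hf hg
    exact hk.comp_continuous (continuous_const.prodMk (hf.prodMk hg)) fun x => ⟨ht, mem_univ _⟩
  have hkt : ∀ x b, ContinuousOn (fun t => k t x b) (Ioi 0) := fun x b =>
    hk.comp (f := fun t => (t, x, b)) (by fun_prop) fun t ht => ⟨ht, mem_univ _⟩
  obtain ⟨c, hc⟩ := exists_slope x₀ hkt hH
  set m : E → E → ℝ := fun x b => k 1 x b - k 1 x₀ b - c x with hm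
  -- Two values of time express the slope through `k`, which makes it continuous although it was
  -- only chosen.
  have hcx : ∀ x, c x = k 2 x x₀ - k 2 x₀ x₀ - (k 1 x x₀ - k 1 x₀ x₀) := by
    intro x
    have := hc 2 two_pos x x₀
    linarith
  have hcc : Continuous c := by
    have : c = fun x => k 2 x x₀ - k 2 x₀ x₀ - (k 1 x x₀ - k 1 x₀ x₀) := funext hcx
    rw [this]
    exact ((hkc 2 _ _ two_pos continuous_id continuous_const).sub continuous_const).sub
      ((hkc 1 _ _ one_pos continuous_id continuous_const).sub continuous_const)
  have hmc : Continuous fun z : E × E => m z.1 z.2 :=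
    ((hkc 1 _ _ one_pos continuous_fst continuous_snd).sub
      (hkc 1 _ _ one_pos continuous_const continuous_snd)).sub (hcc.comp continuous_fst)
  have hm0 : ∀ b, m x₀ b = 0 := by
    intro b
    simp only [hm, hcx]
    ring
  have hmC : ContDiff ℝ 1 fun z : ℝ × ℝ => m (S (Real.exp z.1) x₀) (S (Real.exp z.2) x₀) := by
    have hC' : ∀ t, 0 < t → ∀ f : ℝ × ℝ → ℝ × ℝ, ContDiff ℝ 1 f → ContDiff ℝ 1 fun z : ℝ × ℝ =>
        k t (S (Real.exp (f z).1) x₀) (S (Real.exp (f z).2) x₀) :=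
      fun t ht f hf => (hC t ht).comp hf
    have e : (fun z : ℝ × ℝ => m (S (Real.exp z.1) x₀) (S (Real.exp z.2) x₀)) = fun z =>
        k 1 (S (Real.exp z.1) x₀) (S (Real.exp z.2) x₀) -
        k 1 (S (Real.exp 0) x₀) (S (Real.exp z.2) x₀) -
        (k 2 (S (Real.exp z.1) x₀) (S (Real.exp 0) x₀) - k 2 x₀ x₀ -
          (k 1 (S (Real.exp z.1) x₀) (S (Real.exp 0) x₀) - k 1 x₀ x₀)) := by
      funext z
      simp only [hm, hcx, Real.exp_zero, hS.one]
    rw [e]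
    exact ((hC 1 one_pos).sub (hC' 1 one_pos (fun z => (0, z.2)) (by fun_prop))).sub
      (((hC' 2 two_pos (fun z => (z.1, 0)) (by fun_prop)).sub contDiff_const).sub
      ((hC' 1 one_pos (fun z => (z.1, 0)) (by fun_prop)).sub contDiff_const))
  have hB := reducedExponent_eq hc hH
  have hXY := fun a b b' t (ht : 0 < t) => reducedExponent_space_increments hS hB a b b' ht
  obtain ⟨k₀, hk₀⟩ := exists_homogeneous_of_sub hS x₀ fun b b' t ht => (hXY x₀ b b' t ht).1
  set ρ : E → ℝ := fun x => c x - k₀ with hρ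
  have hX : ∀ a b b' t, 0 < t → k t x₀ b - k t x₀ b' - (ρ b - ρ b') / t +
        (m (S t⁻¹ b) (S t a) - m (S t⁻¹ b') (S t a)) =
      k 1 x₀ b - k 1 x₀ b' - (ρ b - ρ b') + (m b a - m b' a) := by
    intro a b b' t ht
    obtain ⟨e1, e2⟩ := hXY a b b' t ht
    have e3 : (ρ b - ρ b') / t = t * (c (S t⁻¹ b) - c (S t⁻¹ b')) := by
      simp only [hρ]
      rw [div_eq_iff ht.ne']
      linarith
    rw [e3]
    simp only [hρ]
    linarith
  have hK := fun y y' t (ht : 0 < t) =>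
    spatial_increments_eq hS hm0 hB (ρ := ρ) hk₀ hX y y' ht
  have hD := fun a a' b b' t (ht : 0 < t) =>
    double_difference_invariant (K := fun t b => k t x₀ b) hX a a' b b' ht
  obtain ⟨φ, A, B, d, hφ, hA, hBc, hd, hsplit⟩ : ∃ (φ : E → E → ℝ) (A B : E → ℝ) (d : ℝ → ℝ),
      (∀ t, 0 < t → ∀ x y, φ (S t x) y = φ x (S t y)) ∧
      Continuous A ∧ Continuous B ∧ ContinuousOn d (Ioi 0) ∧
      ∀ t, 0 < t → ∀ x y, m x (S t y) + m (S t x₀) y = φ x (S t y) + A x + B y + d t := by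
    rcases hx₀ with h | ⟨σ, hσc, hσ, hσS⟩
    · exact exists_invariant_of_fixed_point hS hmc hm0 hD h
    · exact exists_invariant_of_gauge hS hmc hm0 hD hmC hσc hσ hσS
  set H₁ : E → ℝ := fun y => k 1 x₀ y - ρ y + B y with hH₁
  set δ : ℝ → ℝ := fun t => d t + k₀ * t + (k t x₀ (S t x₀) - t * ρ x₀ -
    (k 1 x₀ x₀ - ρ x₀) - m (S t x₀) x₀) with hδ
  have hform : ∀ t, 0 < t → ∀ x y, k t x (S t y) =
      t * (ρ x + ρ y) + φ x (S t y) + H₁ y + A x + δ t := by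
    intro t ht x y
    have e1 := hc t ht x (S t y)
    have e2 := hK y x₀ t ht
    have e3 := hsplit t ht x y
    simp only [hH₁, hδ]
    have e4 : c x * t = t * ρ x + k₀ * t := by simp only [hρ]; ring
    linarith
  have hform' : ∀ t, 0 < t → ∀ x b, k t x b =
      t * ρ x + ρ b / t + φ x b + H₁ (S t⁻¹ b) + A x + δ t := by
    intro t ht x b
    have := hform t ht x (S t⁻¹ b)
    rw [hS.mul_inv_cancel ht] at this
    have e : ρ (S t⁻¹ b) = (t⁻¹) ^ 2 * ρ b := hk₀ _ (inv_pos.2 ht) b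
    rw [this, e]
    field_simp
  have hρc : Continuous ρ := hcc.sub continuous_const
  have hH₁c : Continuous H₁ :=
    ((hkc 1 _ _ one_pos continuous_const continuous_id).sub hρc).add hBc
  have hSt : ContinuousOn (fun t => S t x₀) (Ioi 0) :=
    hS.continuousOn.comp (f := fun t => (t, x₀)) (by fun_prop) fun t ht => ⟨ht, mem_univ _⟩
  have hδc : ContinuousOn δ (Ioi 0) := by
    refine (hd.add (by fun_prop)).add (((ContinuousOn.sub ?_ (by fun_prop)).sub
      continuousOn_const).sub ?_)
    · exact hk.comp (continuousOn_id.prodMk (continuousOn_const.prodMk hSt))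
        fun t ht => ⟨ht, mem_univ _⟩
    · exact hmc.comp_continuousOn (hSt.prodMk continuousOn_const)
  obtain ⟨β, ν, w, hβ, hδeq⟩ := exists_log_linear (T := fun y => H₁ y + A y) (d := δ) (N := N)
    hS x₀ (hH₁c.add hA) hδc (by
      -- The terms in the last bracket do not involve `t`, so homogeneity becomes exactly the
      -- hypothesis of `exists_log_linear` for `H₁ + A` and `δ`.
      have key : ∀ b r t, 0 < r → r < t → inversionExponent S N k x₀ x₀ b r t =
          H₁ (S t⁻¹ b) + A (S t⁻¹ b) + δ t + δ ((t - r) * t / r) - δ (t - r) -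
            N * Real.log t + (r * ρ x₀ + (ρ b + ρ x₀) / r + φ x₀ b - φ x₀ x₀ +
            φ b (S r⁻¹ x₀)) := by
        intro b r t hr hrt
        have ht : 0 < t := hr.trans hrt
        have hs : 0 < t - r := by linarith
        have hp : 0 < (t - r) * t / r := div_pos (mul_pos hs ht) hr
        have hq : 0 < t / r := div_pos ht hr
        simp only [inversionExponent]
        rw [hform' t ht, hform' _ hs, hform' _ hp, hS.mul _ _ (inv_pos.2 hp) hq,
          hφ _ (inv_pos.2 ht), hS.mul _ _ (inv_pos.2 ht) hq,
          show ρ (S t⁻¹ b) = (t⁻¹) ^ 2 * ρ b from hk₀ _ (inv_pos.2 ht) b,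
          show ρ (S (t / r) x₀) = (t / r) ^ 2 * ρ x₀ from hk₀ _ hq x₀,
          show ((t - r) * t / r)⁻¹ * (t / r) = (t - r)⁻¹ by field_simp,
          show t⁻¹ * (t / r) = r⁻¹ by field_simp]
        have e : t * ρ x₀ + ρ b / t + ((t - r) * t / r * (t⁻¹ ^ 2 * ρ b) +
            (t / r) ^ 2 * ρ x₀ / ((t - r) * t / r)) - ((t - r) * ρ x₀ + ρ x₀ / (t - r)) =
            r * ρ x₀ + (ρ b + ρ x₀) / r := by
          field_simp
          ring
        linarith
      intro b r t t' hr ht ht'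
      have e1 := key b r t hr ht
      have e2 := key b r t' hr ht'
      have e3 := hH x₀ x₀ b r t t' hr ht ht'
      linarith)
  -- The sum `H₁ y + A x` is rewritten as `(H₁ y + A y) + (A x - A y)`: the first part has the
  -- scaling property, the second is the `h`-transform.
  refine ⟨φ, ρ, fun y => H₁ y + A y + w, fun y => -A y, β, ν, hφ, hk₀, ?_, hA.neg, ?_⟩
  · intro t ht y
    have := hβ t ht y
    linarith
  · intro t ht x y
    rw [hform t ht x y, hδeq t ht]
    ring

end Decomposition

/-! ### Transition kernels from densities -/

section DensityKernel

open scoped ENNReal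

/-- The density `p t a b`, with values in `ℝ≥0∞` and extended by zero off `E × E`. -/
noncomputable def eDensity {V : Type*} (E : Set V) (p : ℝ → V → V → ℝ) (t : ℝ) (a b : V) : ℝ≥0∞ :=
  (E ×ˢ E).indicator (fun z => ENNReal.ofReal (p t z.1 z.2)) (a, b)

variable {V : Type*} {E : Set V} {p : ℝ → V → V → ℝ}

theorem eDensity_of_mem {t : ℝ} {a b : V} (ha : a ∈ E) (hb : b ∈ E) :
    eDensity E p t a b = ENNReal.ofReal (p t a b) :=
  indicator_of_mem (s := E ×ˢ E) ⟨ha, hb⟩ _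

theorem eDensity_of_notMem_left {t : ℝ} {a b : V} (ha : a ∉ E) : eDensity E p t a b = 0 :=
  indicator_of_notMem (fun h => ha h.1) _

theorem eDensity_of_notMem_right {t : ℝ} {a b : V} (hb : b ∉ E) : eDensity E p t a b = 0 :=
  indicator_of_notMem (fun h => hb h.2) _

theorem eDensity_eq_indicator {t : ℝ} {a : V} (ha : a ∈ E) :
    eDensity E p t a = E.indicator fun b => ENNReal.ofReal (p t a b) := by
  funext b
  by_cases hb : b ∈ E
  · rw [eDensity_of_mem ha hb, indicator_of_mem hb]
  · rw [eDensity_of_notMem_right hb, indicator_of_notMem hb]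

theorem eDensity_ne_top {t : ℝ} {a b : V} : eDensity E p t a b ≠ ∞ := by
  by_cases ha : a ∈ E
  · by_cases hb : b ∈ E
    · rw [eDensity_of_mem ha hb]; exact ENNReal.ofReal_ne_top
    · rw [eDensity_of_notMem_right hb]; exact ENNReal.zero_ne_top
  · rw [eDensity_of_notMem_left ha]; exact ENNReal.zero_ne_top

variable [MeasureSpace V]

theorem densityMeasure_eq_withDensity (hE : MeasurableSet E) {t : ℝ} {a : V} (ha : a ∈ E) :
    densityMeasure E p t a = (volume : Measure V).withDensity (eDensity E p t a) := by
  rw [densityMeasure, eDensity_eq_indicator ha, withDensity_indicator hE]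

theorem IsSemigroupDensity.lintegral_eDensity (hp : IsSemigroupDensity E p) (hE : MeasurableSet E)
    {t : ℝ} (ht : 0 < t) {a : V} (ha : a ∈ E) : ∫⁻ b, eDensity E p t a b = 1 := by
  rw [eDensity_eq_indicator ha, lintegral_indicator hE, hp.mass t ht a ha]

theorem IsSemigroupDensity.lintegral_eDensity_mul (hp : IsSemigroupDensity E p)
    (hE : MeasurableSet E) {s t : ℝ} (hs : 0 < s) (ht : 0 < t) {a : V} (ha : a ∈ E) (b : V) :
    ∫⁻ z, eDensity E p s a z * eDensity E p t z b = eDensity E p (s + t) a b := by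
  by_cases hb : b ∈ E
  · rw [eDensity_of_mem ha hb, ← hp.chapman_kolmogorov s t hs ht a ha b hb,
      ← lintegral_indicator hE]
    refine lintegral_congr fun z => ?_
    by_cases hz : z ∈ E
    · rw [indicator_of_mem hz, eDensity_of_mem ha hz, eDensity_of_mem hz hb]
    · rw [indicator_of_notMem hz, eDensity_of_notMem_right hz, zero_mul]
  · simp [eDensity_of_notMem_right hb]

open Classical in
/-- The kernel `p t a b db` for `a ∈ E`, extended by the Dirac mass at `a` for `a ∉ E`. -/
noncomputable def densityKernel [SFinite (volume : Measure V)] (hE : MeasurableSet E)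
    (p : ℝ → V → V → ℝ) (t : ℝ) : Kernel V V :=
  Kernel.piecewise hE (Kernel.withDensity (Kernel.const V volume) (eDensity E p t)) Kernel.id

variable [SFinite (volume : Measure V)]

theorem densityKernel_of_mem (hE : MeasurableSet E) {t : ℝ}
    (hm : Measurable (Function.uncurry (eDensity E p t))) {a : V} (ha : a ∈ E) :
    densityKernel hE p t a = (volume : Measure V).withDensity (eDensity E p t a) := by
  classical
  rw [densityKernel, Kernel.piecewise_apply, if_pos ha, Kernel.withDensity_apply _ hm,
    Kernel.const_apply]

theorem densityKernel_of_notMem (hE : MeasurableSet E) {t : ℝ} {a : V} (ha : a ∉ E) :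
    densityKernel hE p t a = Measure.dirac a := by
  classical
  rw [densityKernel, Kernel.piecewise_apply, if_neg ha, Kernel.id_apply]

theorem isMarkovKernel_densityKernel (hE : MeasurableSet E) (hp : IsSemigroupDensity E p) {t : ℝ}
    (ht : 0 < t) (hm : Measurable (Function.uncurry (eDensity E p t))) :
    IsMarkovKernel (densityKernel hE p t) := by
  refine ⟨fun a => ⟨?_⟩⟩
  by_cases ha : a ∈ E
  · rw [densityKernel_of_mem hE hm ha, withDensity_apply _ MeasurableSet.univ,
      Measure.restrict_univ, hp.lintegral_eDensity hE ht ha]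
  · rw [densityKernel_of_notMem hE ha, measure_univ]

/-- On `E` this is Tonelli and Chapman–Kolmogorov; off `E` both sides are the Dirac mass, which
makes the extension a semigroup on the whole space. -/
theorem densityKernel_add (hE : MeasurableSet E) (hp : IsSemigroupDensity E p)
    (hm : ∀ t, 0 < t → Measurable (Function.uncurry (eDensity E p t))) {r s : ℝ}
    (hr : 0 < r) (hs : 0 < s) :
    densityKernel hE p (r + s) = densityKernel hE p s ∘ₖ densityKernel hE p r := by
  ext a A hA
  rw [Kernel.comp_apply' _ _ _ hA]
  by_cases ha : a ∈ E
  · have hk : Measurable fun b => densityKernel hE p s b A := Kernel.measurable_coe _ hA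
    rw [densityKernel_of_mem hE (hm r hr) ha, densityKernel_of_mem hE (hm _ (add_pos hr hs)) ha,
      withDensity_apply _ hA,
      lintegral_withDensity_eq_lintegral_mul _ ((hm r hr).of_uncurry_left) hk]
    have e : ∀ b, (eDensity E p r a * fun b => densityKernel hE p s b A) b =
        ∫⁻ c in A, eDensity E p r a b * eDensity E p s b c := by
      intro b
      rw [Pi.mul_apply]
      by_cases hb : b ∈ E
      · rw [densityKernel_of_mem hE (hm s hs) hb, withDensity_apply _ hA,
          lintegral_const_mul _ ((hm s hs).of_uncurry_left)]
      · simp [eDensity_of_notMem_right hb]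
    rw [lintegral_congr e, lintegral_lintegral_swap]
    · refine lintegral_congr fun c => ?_
      rw [hp.lintegral_eDensity_mul hE hr hs ha]
    · refine Measurable.aemeasurable ?_
      exact ((hm r hr).of_uncurry_left.comp measurable_fst).mul (hm s hs)
  · rw [densityKernel_of_notMem hE ha, densityKernel_of_notMem hE ha,
      lintegral_dirac' _ (Kernel.measurable_coe _ hA), densityKernel_of_notMem hE ha]

end DensityKernel

/-! ### Markov property for events in the future -/

section Markov

open scoped ENNReal

variable {Ω V : Type*} [MeasurableSpace V] {T : Set ℝ} {Y : ℝ → Ω → V}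

theorem measurable_past {s u : ℝ} (hu : u ∈ T) (hus : u ≤ s) : Measurable[past T Y s] (Y u) :=
  Measurable.mono (comap_measurable (Y u))
    (le_iSup₂_of_le (f := fun u (_ : u ∈ T ∩ Iic s) => MeasurableSpace.comap (Y u) inferInstance)
      u ⟨hu, hus⟩ le_rfl) le_rfl

theorem past_mono {s t : ℝ} (hst : s ≤ t) : past T Y s ≤ past T Y t :=
  biSup_mono fun _ hu => ⟨hu.1, hu.2.trans hst⟩

variable [MeasurableSpace Ω] {μ : Measure Ω} {Q : ℝ → V → Measure V}

theorem past_le (hY : ∀ t ∈ T, Measurable (Y t)) (s : ℝ) :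
    past T Y s ≤ (inferInstance : MeasurableSpace Ω) :=
  iSup₂_le fun u hu => (hY u hu.1).comap_le

/-- The Markov property integrated over a past event `G`: an identity of measures, usable for all
nonnegative functions. `Q` is not assumed measurable, hence the kernel `κ` that agrees with it
almost surely along the path. -/
theorem IsMarkovWith.map_restrict [IsProbabilityMeasure μ] (h : IsMarkovWith T Y μ Q) {s t : ℝ}
    (hs : s ∈ T) (ht : t ∈ T) (hst : s < t) {κ : Kernel V V} [IsMarkovKernel κ]
    (hκ : ∀ᵐ ω ∂μ, Q (t - s) (Y s ω) = κ (Y s ω)) {G : Set Ω}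
    (hG : MeasurableSet[past T Y s] G) :
    (μ.restrict G).map (Y t) = ((μ.restrict G).map (Y s)).bind κ := by
  have hm := past_le h.measurable s
  have hYs := h.measurable s hs
  have hYt := h.measurable t ht
  ext A hA
  have hB : MeasurableSet (Y t ⁻¹' A) := hYt hA
  have hκA : Measurable fun y => κ y A := Kernel.measurable_coe _ hA
  rw [Measure.map_apply hYt hA, Measure.bind_apply hA κ.measurable.aemeasurable,
    lintegral_map hκA hYs]
  have hle : ∀ ω, κ (Y s ω) A ≤ 1 := fun ω => prob_le_one
  have hfin : ∫⁻ ω in G, κ (Y s ω) A ∂μ ≠ ∞ := by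
    refine ((lintegral_mono hle).trans_lt ?_).ne
    simp
  rw [← ENNReal.toReal_eq_toReal_iff' (measure_ne_top _ _) hfin,
    ← integral_toReal (f := fun ω => κ (Y s ω) A) (hκA.comp hYs).aemeasurable
      (ae_of_all _ fun ω => (hle ω).trans_lt ENNReal.one_lt_top)]
  have e1 : ∫ ω in G, (μ⟦Y t ⁻¹' A | past T Y s⟧) ω ∂μ =
      ∫ ω in G, (Y t ⁻¹' A).indicator (fun _ => (1 : ℝ)) ω ∂μ :=
    setIntegral_condExp hm ((integrable_const _).indicator hB) hG
  have e2 : ∫ ω in G, (Y t ⁻¹' A).indicator (fun _ => (1 : ℝ)) ω ∂μ =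
      (μ.restrict G (Y t ⁻¹' A)).toReal :=
    integral_indicator_one hB
  rw [← e2, ← e1]
  refine integral_congr_ae (ae_restrict_of_ae ?_)
  filter_upwards [h.condProb s hs t ht hst A hA, hκ] with ω h1 h2
  rw [h1, h2, measureReal_def]

/-- The event `F` has, given the past up to time `v`, a conditional probability that is a function
of the position at time `v`. -/
def HasConditionalProb (T : Set ℝ) (Y : ℝ → Ω → V) (μ : Measure Ω) (v : ℝ) (F : Set Ω) : Prop :=
  ∃ g : V → ℝ≥0∞, Measurable g ∧ ∀ G, MeasurableSet[past T Y v] G →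
    μ (G ∩ F) = ∫⁻ ω in G, g (Y v ω) ∂μ

/-- The tower property: averaging the conditional probability at time `t` against `κ` gives the one
at time `s`. -/
theorem HasConditionalProb.anti [IsProbabilityMeasure μ] (h : IsMarkovWith T Y μ Q) {s t : ℝ}
    (hs : s ∈ T) (ht : t ∈ T) (hst : s < t) {κ : Kernel V V} [IsMarkovKernel κ]
    (hκ : ∀ᵐ ω ∂μ, Q (t - s) (Y s ω) = κ (Y s ω)) {F : Set Ω}
    (hF : HasConditionalProb T Y μ t F) : HasConditionalProb T Y μ s F := by
  obtain ⟨g, hg, hgF⟩ := hF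
  have hκg : Measurable fun y => ∫⁻ z, g z ∂κ y := hg.lintegral_kernel
  refine ⟨fun y => ∫⁻ z, g z ∂κ y, hκg, fun G hG => ?_⟩
  rw [hgF G (past_mono hst.le G hG), ← lintegral_map hg (h.measurable t ht),
    h.map_restrict hs ht hst hκ hG,
    Measure.lintegral_bind κ.measurable.aemeasurable hg.aemeasurable,
    lintegral_map hκg (h.measurable s hs)]

/-- Backward induction on the times: the factor at the earliest time `a` is an indicator of the
position, which multiplies the function obtained from the later times; the product is then carried
back to `v`. -/
theorem hasConditionalProb_cylinder [IsProbabilityMeasure μ] (h : IsMarkovWith T Y μ Q)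
    {κ : ℝ → Kernel V V} (hMk : ∀ r, 0 < r → IsMarkovKernel (κ r))
    (hκ : ∀ s ∈ T, ∀ r, 0 < r → ∀ᵐ ω ∂μ, Q r (Y s ω) = κ r (Y s ω))
    (f : ℝ → Set Ω) (I : Finset ℝ) :
    (↑I ⊆ T) → (∀ u ∈ I, MeasurableSet[MeasurableSpace.comap (Y u) inferInstance] (f u)) →
    ∀ v ∈ T, (∀ u ∈ I, v ≤ u) → HasConditionalProb T Y μ v (⋂ u ∈ I, f u) := by
  classical
  induction I using Finset.induction_on_min with
  | empty =>
    intro _ _ v hv _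
    refine ⟨fun _ => 1, measurable_const, fun G hG => ?_⟩
    simp
  | insert a I ha ih =>
    intro hI hf v hv hvI
    have haT : a ∈ T := hI (by simp)
    obtain ⟨g, hg, hgF⟩ := ih (fun u hu => hI (by simp at hu ⊢; exact Or.inr hu))
      (fun u hu => hf u (by simp [hu])) a haT fun u hu => (ha u hu).le
    obtain ⟨B, hB, hBf⟩ := hf a (by simp)
    have hFa : HasConditionalProb T Y μ a (⋂ u ∈ insert a I, f u) := by
      refine ⟨B.indicator g, hg.indicator hB, fun G hG => ?_⟩
      rw [Finset.set_biInter_insert, ← hBf, ← inter_assoc,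
        hgF _ (hG.inter (measurable_past haT le_rfl hB)), inter_comm G,
        ← Measure.restrict_restrict (h.measurable a haT hB),
        ← lintegral_indicator (h.measurable a haT hB)]
      rfl
    rcases (hvI a (by simp)).eq_or_lt with rfl | hva
    · exact hFa
    · have := hMk (a - v) (by linarith)
      exact hFa.anti h hv haT hva (hκ v hv _ (by linarith))

/-- On functions of `Y v`, restricting to `F` amounts to weighting the law of `Y v` by `g`. -/
theorem HasConditionalProb.setLIntegral {v : ℝ} {F : Set Ω} (hY : ∀ t ∈ T, Measurable (Y t))
    (hv : v ∈ T) {g : V → ℝ≥0∞} (hg : Measurable g)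
    (hgF : ∀ G, MeasurableSet[past T Y v] G → μ (G ∩ F) = ∫⁻ ω in G, g (Y v ω) ∂μ)
    {ψ : V → ℝ≥0∞} (hψ : Measurable ψ) :
    ∫⁻ ω in F, ψ (Y v ω) ∂μ = ∫⁻ ω, g (Y v ω) * ψ (Y v ω) ∂μ := by
  have hYv := hY v hv
  have : (μ.restrict F).map (Y v) = (μ.map (Y v)).withDensity g := by
    ext B hB
    rw [Measure.map_apply hYv hB, Measure.restrict_apply (hYv hB),
      hgF _ (measurable_past hv le_rfl hB), withDensity_apply _ hB, setLIntegral_map hB hg hYv]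
  rw [← lintegral_map hψ hYv, this, lintegral_withDensity_eq_lintegral_mul _ hg hψ,
    lintegral_map (hg.mul hψ) hYv]
  rfl

theorem condProb_ae_eq_toReal {Ω : Type*} {m m₀ : MeasurableSpace Ω} {μ : Measure Ω}
    [IsFiniteMeasure μ] (hm : m ≤ m₀) {B : Set Ω} (hB : MeasurableSet B)
    {f : Ω → ℝ≥0∞} (hf : Measurable[m] f)
    (h : ∀ F, MeasurableSet[m] F → μ (B ∩ F) = ∫⁻ ω in F, f ω ∂μ) :
    μ⟦B | m⟧ =ᵐ[μ] fun ω => (f ω).toReal := by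
  have hf0 : Measurable f := hf.mono hm le_rfl
  have hfin : ∫⁻ ω, f ω ∂μ ≠ ∞ := by
    have := h univ MeasurableSet.univ
    rw [Measure.restrict_univ] at this
    rw [← this]
    exact measure_ne_top _ _
  have hint : Integrable (fun ω => (f ω).toReal) μ :=
    integrable_toReal_of_lintegral_ne_top hf0.aemeasurable hfin
  refine (ae_eq_condExp_of_forall_setIntegral_eq hm ((integrable_const _).indicator hB)
    (fun _ _ _ => hint.integrableOn) (fun F hF _ => ?_) ?_).symm
  · rw [integral_toReal hf0.aemeasurable (ae_restrict_of_ae (ae_lt_top hf0 hfin)), ← h F hF]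
    have e2 : ∫ ω in F, B.indicator (fun _ => (1 : ℝ)) ω ∂μ = (μ.restrict F B).toReal :=
      integral_indicator_one hB
    rw [e2, Measure.restrict_apply hB]
  · exact hf.ennreal_toReal.stronglyMeasurable.aestronglyMeasurable

end Markov

/-! ### Time reversal by Bayes' formula -/

section Reversal

open scoped ENNReal

variable {Ω V : Type*} [MeasurableSpace Ω] [MeasureSpace V] [SFinite (volume : Measure V)]
  {E : Set V} {X : ℝ → Ω → V} {P : V → Measure Ω} {p : ℝ → V → V → ℝ}

theorem IsMarkovProcess.map_eq (hX : IsMarkovProcess E X P p) (hE : MeasurableSet E)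
    (hm : ∀ t, 0 < t → Measurable (Function.uncurry (eDensity E p t))) {x : V} (hx : x ∈ E)
    {t : ℝ} (ht : 0 < t) :
    (P x).map (X t) = (volume : Measure V).withDensity (eDensity E p t x) := by
  have := hX.prob x hx
  have := isMarkovKernel_densityKernel hE hX.semigroup ht (hm t ht)
  have h0 : (P x).map (X 0) = Measure.dirac x := by
    have e : X 0 =ᵐ[P x] fun _ => x := hX.start x hx
    rw [Measure.map_congr e, Measure.map_const, measure_univ, one_smul]
  have hκ : ∀ᵐ ω ∂(P x), densityMeasure E p (t - 0) (X 0 ω) = densityKernel hE p t (X 0 ω) := by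
    filter_upwards [hX.start x hx] with ω hω
    rw [hω, sub_zero, densityKernel_of_mem hE (hm t ht) hx, densityMeasure_eq_withDensity hE hx]
  have h := (hX.markov x hx).map_restrict (mem_Ici.2 le_rfl) (mem_Ici.2 ht.le) ht hκ
    (G := univ) MeasurableSet.univ
  rwa [Measure.restrict_univ, h0, Measure.dirac_bind (Kernel.measurable _),
    densityKernel_of_mem hE (hm t ht) hx] at h

theorem IsMarkovProcess.ae_mem (hX : IsMarkovProcess E X P p) (hE : MeasurableSet E)
    (hm : ∀ t, 0 < t → Measurable (Function.uncurry (eDensity E p t))) {x : V} (hx : x ∈ E)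
    {t : ℝ} (ht : 0 ≤ t) : ∀ᵐ ω ∂(P x), X t ω ∈ E := by
  rcases ht.eq_or_lt with rfl | ht
  · filter_upwards [hX.start x hx] with ω hω
    rwa [hω]
  · have hXt := (hX.markov x hx).measurable t (mem_Ici.2 ht.le)
    refine ae_of_ae_map hXt.aemeasurable (p := fun y => y ∈ E) ?_
    rw [hX.map_eq hE hm hx ht, eDensity_eq_indicator hx, withDensity_indicator hE]
    exact (withDensity_absolutelyContinuous _ _).ae_le (ae_restrict_mem hE)

/-- The probability of being in `A` at time `w`, given the position `z` at the later time `v`. -/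
noncomputable def backwardProb (E : Set V) (p : ℝ → V → V → ℝ) (x : V) (w v : ℝ) (A : Set V)
    (z : V) : ℝ≥0∞ :=
  (∫⁻ y in A, eDensity E p w x y * eDensity E p (v - w) y z) / eDensity E p v x z

theorem measurable_lintegral_eDensity_mul
    (hm : ∀ t, 0 < t → Measurable (Function.uncurry (eDensity E p t)))
    (x : V) {w v : ℝ} (hw : 0 < w) (hwv : w < v) (A : Set V) :
    Measurable fun z => ∫⁻ y in A, eDensity E p w x y * eDensity E p (v - w) y z := by
  refine Measurable.lintegral_prod_right' (f := fun zy : V × V =>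
    eDensity E p w x zy.2 * eDensity E p (v - w) zy.2 zy.1) ?_
  exact ((hm w hw).of_uncurry_left.comp measurable_snd).mul
    ((hm (v - w) (by linarith)).comp measurable_swap)

theorem measurable_backwardProb
    (hm : ∀ t, 0 < t → Measurable (Function.uncurry (eDensity E p t)))
    (x : V) {w v : ℝ} (hw : 0 < w) (hwv : w < v) (A : Set V) :
    Measurable (backwardProb E p x w v A) :=
  (measurable_lintegral_eDensity_mul hm x hw hwv A).div
    (hm v (hw.trans hwv)).of_uncurry_left

/-- Both sides equal the integral of `p_w(x, y) p_{v-w}(y, z) g z` over `y ∈ A` and all `z`, where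
`g` is the conditional probability of `F`: the denominator of `backwardProb` cancels the density of
`X v`. -/
theorem IsMarkovProcess.measure_inter_of_hasConditionalProb (hX : IsMarkovProcess E X P p)
    (hE : MeasurableSet E)
    (hm : ∀ t, 0 < t → Measurable (Function.uncurry (eDensity E p t))) {x : V} (hx : x ∈ E)
    {w v : ℝ} (hw : 0 < w) (hwv : w < v) {A : Set V} (hA : MeasurableSet A) {F : Set Ω}
    (hF : HasConditionalProb (Ici 0) X (P x) v F) :
    P x (X w ⁻¹' A ∩ F) = ∫⁻ ω in F, backwardProb E p x w v A (X v ω) ∂(P x) := by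
  have := hX.prob x hx
  have hv : 0 < v := hw.trans hwv
  have hr : 0 < v - w := by linarith
  have hMk := isMarkovKernel_densityKernel hE hX.semigroup hr (hm _ hr)
  have hmeas := (hX.markov x hx).measurable
  have hvT : v ∈ Ici (0 : ℝ) := mem_Ici.2 hv.le
  have hwT : w ∈ Ici (0 : ℝ) := mem_Ici.2 hw.le
  have hXw := hmeas w hwT
  have hXv := hmeas v hvT
  obtain ⟨g, hg, hgF⟩ := hF
  have hR := measurable_backwardProb hm x hw hwv A
  have hκ : ∀ᵐ ω ∂(P x), densityMeasure E p (v - w) (X w ω) =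
      densityKernel hE p (v - w) (X w ω) := by
    filter_upwards [hX.ae_mem hE hm hx hw.le] with ω hω
    rw [densityKernel_of_mem hE (hm _ hr) hω, densityMeasure_eq_withDensity hE hω]
  have hG : MeasurableSet[past (Ici 0) X w] (X w ⁻¹' A) := measurable_past hwT le_rfl hA
  have hκg : Measurable fun y => ∫⁻ z, g z ∂(densityKernel hE p (v - w) y) := hg.lintegral_kernel
  have ew := (hm w hw).of_uncurry_left (x := x)
  have ev := (hm v hv).of_uncurry_left (x := x)
  have er := hm (v - w) hr
  rw [HasConditionalProb.setLIntegral hmeas hvT hg hgF hR, hgF _ (past_mono hwv.le _ hG),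
    ← lintegral_map hg hXv, (hX.markov x hx).map_restrict hwT hvT hwv hκ hG,
    Measure.lintegral_bind (Kernel.measurable _).aemeasurable hg.aemeasurable,
    ← Measure.restrict_map hXw hA, hX.map_eq hE hm hx hw,
    setLIntegral_withDensity_eq_setLIntegral_mul _ ew hκg hA]
  have e1 : ∀ y, (eDensity E p w x * fun y => ∫⁻ z, g z ∂(densityKernel hE p (v - w) y)) y =
      ∫⁻ z, eDensity E p w x y * eDensity E p (v - w) y z * g z := by
    intro y
    rw [Pi.mul_apply]
    by_cases hy : y ∈ E
    · have ey := er.of_uncurry_left (x := y)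
      rw [densityKernel_of_mem hE er hy, lintegral_withDensity_eq_lintegral_mul _ ey hg,
        ← lintegral_const_mul _ (ey.mul hg)]
      exact lintegral_congr fun z => (mul_assoc _ _ _).symm
    · simp [eDensity_of_notMem_right hy]
  rw [lintegral_congr e1, lintegral_lintegral_swap]
  · rw [← lintegral_map (f := fun z => g z * backwardProb E p x w v A z) (hg.mul hR) hXv,
      hX.map_eq hE hm hx hv, lintegral_withDensity_eq_lintegral_mul _ ev
        (g := fun z => g z * backwardProb E p x w v A z) (hg.mul hR)]
    refine lintegral_congr fun z => ?_
    have hyz : Measurable fun y => eDensity E p w x y * eDensity E p (v - w) y z :=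
      ew.mul er.of_uncurry_right
    rw [lintegral_mul_const _ hyz]
    simp only [Pi.mul_apply, backwardProb]
    by_cases hz : z ∈ E
    · have hpos : eDensity E p v x z ≠ 0 := by
        rw [eDensity_of_mem hx hz]
        exact (ENNReal.ofReal_pos.2 (hX.semigroup.pos v hv x hx z hz)).ne'
      rw [mul_left_comm, ENNReal.mul_div_cancel hpos eDensity_ne_top, mul_comm]
    · simp [eDensity_of_notMem_right hz]
  · refine Measurable.aemeasurable ?_
    exact ((ew.comp measurable_fst).mul er).mul (hg.comp measurable_snd)

/-- The Markov property in reversed time. -/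
theorem IsMarkovProcess.measure_inter_future (hX : IsMarkovProcess E X P p)
    (hE : MeasurableSet E)
    (hm : ∀ t, 0 < t → Measurable (Function.uncurry (eDensity E p t))) {x : V} (hx : x ∈ E)
    {w v : ℝ} (hw : 0 < w) (hwv : w < v) {A : Set V} (hA : MeasurableSet A) {F : Set Ω}
    (hF : MeasurableSet[⨆ u ∈ Ici v, MeasurableSpace.comap (X u) inferInstance] F) :
    P x (X w ⁻¹' A ∩ F) = ∫⁻ ω in F, backwardProb E p x w v A (X v ω) ∂(P x) := by
  have := hX.prob x hx
  have hv : 0 < v := hw.trans hwv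
  have hmeas := (hX.markov x hx).measurable
  have hXw := hmeas w (mem_Ici.2 hw.le)
  have hle : (⨆ u ∈ Ici v, MeasurableSpace.comap (X u) inferInstance) ≤
      (inferInstance : MeasurableSpace Ω) :=
    iSup₂_le fun u hu => (hmeas u (mem_Ici.2 (hv.le.trans hu))).comap_le
  -- Finite intersections of events at times at least `v` form a generating π-system. For them the
  -- forward Markov property supplies the conditional probability.
  have hcyl : ∀ F ∈ piiUnionInter
      (fun u => {s | MeasurableSet[MeasurableSpace.comap (X u) inferInstance] s}) (Ici v),
      P x (X w ⁻¹' A ∩ F) = ∫⁻ ω in F, backwardProb E p x w v A (X v ω) ∂(P x) := by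
    rintro F ⟨I, hI, f, hf, rfl⟩
    refine hX.measure_inter_of_hasConditionalProb hE hm hx hw hwv hA ?_
    refine hasConditionalProb_cylinder (hX.markov x hx) (κ := densityKernel hE p)
      (fun r hr => isMarkovKernel_densityKernel hE hX.semigroup hr (hm r hr))
      (fun s hs r hr => ?_) f I (fun u hu => mem_Ici.2 (hv.le.trans (hI hu))) hf v
      (mem_Ici.2 hv.le) (fun u hu => hI hu)
    filter_upwards [hX.ae_mem hE hm hx hs] with ω hω
    rw [densityKernel_of_mem hE (hm _ hr) hω, densityMeasure_eq_withDensity hE hω]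
  -- Both sides of the claim are finite measures in `F`; they are compared on the σ-algebra of the
  -- future, hence the trims.
  have hext : ((P x).restrict (X w ⁻¹' A)).trim hle =
      ((P x).withDensity fun ω => backwardProb E p x w v A (X v ω)).trim hle := by
    have aux : ∀ F, MeasurableSet[⨆ u ∈ Ici v, MeasurableSpace.comap (X u) inferInstance] F →
        P x (X w ⁻¹' A ∩ F) = ∫⁻ ω in F, backwardProb E p x w v A (X v ω) ∂(P x) →
        ((P x).restrict (X w ⁻¹' A)).trim hle F =
        ((P x).withDensity fun ω => backwardProb E p x w v A (X v ω)).trim hle F := by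
      intro F hF h
      rw [trim_measurableSet_eq hle hF, trim_measurableSet_eq hle hF,
        Measure.restrict_apply (hle F hF), withDensity_apply _ (hle F hF), inter_comm, h]
    have hgen := generateFrom_piiUnionInter_measurableSet
      (fun u => MeasurableSpace.comap (X u) inferInstance) (Ici v)
    refine ext_of_generate_finite _ hgen.symm (isPiSystem_piiUnionInter _
      (fun u => @MeasurableSpace.isPiSystem_measurableSet _
        (MeasurableSpace.comap (X u) inferInstance)) _) (fun F hF => aux F ?_ (hcyl F hF))
        (aux univ MeasurableSet.univ (hcyl _ ⟨∅, by simp, fun _ => univ, by simp, by simp⟩))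
    rw [← hgen]
    exact MeasurableSpace.measurableSet_generateFrom hF
  have h := DFunLike.congr_fun hext F
  rwa [trim_measurableSet_eq hle hF, trim_measurableSet_eq hle hF,
    Measure.restrict_apply (hle F hF), withDensity_apply _ (hle F hF), inter_comm] at h

end Reversal

/-! ### Transition densities of the inverted process -/

section Inversion

open scoped ENNReal

variable {n : ℕ} {α : ℝ} {E : Set (EuclideanSpace ℝ (Fin n))}
  {p q : ℝ → EuclideanSpace ℝ (Fin n) → EuclideanSpace ℝ (Fin n) → ℝ}
  {x a b : EuclideanSpace ℝ (Fin n)} {s t u : ℝ}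

theorem lintegral_comp_smul_eq {c : ℝ} (hc : 0 < c) (f : EuclideanSpace ℝ (Fin n) → ℝ≥0∞) :
    ∫⁻ y, f (c • y) = ENNReal.ofReal (c ^ n)⁻¹ * ∫⁻ b, f b := by
  have h := Measure.map_addHaar_smul (volume : Measure (EuclideanSpace ℝ (Fin n))) hc.ne'
  have he : MeasurableEmbedding fun y : EuclideanSpace ℝ (Fin n) => c • y :=
    measurableEmbedding_const_smul₀ hc.ne'
  rw [← he.lintegral_map, h, lintegral_smul_measure, finrank_euclideanSpace_fin,
    abs_of_pos (by positivity), smul_eq_mul]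

theorem smul_mem_iff_of_cone (hcone : ∀ c : ℝ, 0 < c → ∀ x ∈ E, c • x ∈ E) {c : ℝ} (hc : 0 < c) :
    c • x ∈ E ↔ x ∈ E := by
  refine ⟨fun h => ?_, hcone c hc x⟩
  have := hcone c⁻¹ (inv_pos.2 hc) _ h
  rwa [inv_smul_smul₀ hc.ne'] at this

theorem one_div_sub_pos (hs : 0 < s) (hst : s < t) : 0 < 1 / s - 1 / t :=
  sub_pos.2 (one_div_lt_one_div_of_lt hs hst)

theorem invertedDensity_pos (hp : IsSemigroupDensity E p)
    (hcone : ∀ c : ℝ, 0 < c → ∀ x ∈ E, c • x ∈ E) (hx : x ∈ E) (hs : 0 < s) (hst : s < t)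
    (ha : a ∈ E) (hb : b ∈ E) : 0 < invertedDensity α p x s t a b := by
  have ht : 0 < t := hs.trans hst
  have hs' : 0 < (s ^ α)⁻¹ := by positivity
  have ht' : 0 < (t ^ α)⁻¹ := by positivity
  have h1 := hp.pos (1 / t) (by positivity) x hx _ (hcone _ ht' _ hb)
  have h2 := hp.pos _ (one_div_sub_pos hs hst) _ (hcone _ ht' _ hb) _ (hcone _ hs' _ ha)
  have h3 := hp.pos (1 / s) (by positivity) x hx _ (hcone _ hs' _ ha)
  unfold invertedDensity
  positivity

theorem rpow_neg_mul_eq (ht : 0 < t) : t ^ (-(n * α)) = ((t ^ α) ^ n)⁻¹ := by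
  rw [Real.rpow_neg ht.le, mul_comm, Real.rpow_mul_natCast ht.le]

theorem ofReal_invertedDensity (hp : IsSemigroupDensity E p)
    (hcone : ∀ c : ℝ, 0 < c → ∀ x ∈ E, c • x ∈ E) (hx : x ∈ E) (hs : 0 < s) (hst : s < t)
    (ha : a ∈ E) (hb : b ∈ E) : ENNReal.ofReal (invertedDensity α p x s t a b) =
      ENNReal.ofReal ((t ^ α) ^ n)⁻¹ * (eDensity E p (1 / t) x ((t ^ α)⁻¹ • b) *
        eDensity E p (1 / s - 1 / t) ((t ^ α)⁻¹ • b) ((s ^ α)⁻¹ • a) *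
        (eDensity E p (1 / s) x ((s ^ α)⁻¹ • a))⁻¹) := by
  have ht : 0 < t := hs.trans hst
  have hs' : 0 < (s ^ α)⁻¹ := by positivity
  have ht' : 0 < (t ^ α)⁻¹ := by positivity
  have hb' := hcone _ ht' _ hb
  have ha' := hcone _ hs' _ ha
  have h1 := hp.pos (1 / t) (by positivity) x hx _ hb'
  have h2 := hp.pos _ (one_div_sub_pos hs hst) _ hb' _ ha'
  have h3 := hp.pos (1 / s) (by positivity) x hx _ ha'
  rw [eDensity_of_mem hx hb', eDensity_of_mem hb' ha', eDensity_of_mem hx ha',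
    ← ENNReal.ofReal_inv_of_pos h3, ← ENNReal.ofReal_mul h1.le,
    ← ENNReal.ofReal_mul (mul_pos h1 h2).le, ← ENNReal.ofReal_mul (by positivity),
    invertedDensity, rpow_neg_mul_eq ht]
  congr 1
  rw [div_eq_mul_inv, mul_assoc]

/-- The substitution `b = t ^ α • y`, whose Jacobian is the factor `t ^ (-(n * α))`, identifies
`invertedDensity` with Bayes' formula for `X`. -/
theorem setLIntegral_invertedDensity (hp : IsSemigroupDensity E p) (hE : MeasurableSet E)
    (hm : ∀ t, 0 < t → Measurable (Function.uncurry (eDensity E p t)))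
    (hcone : ∀ c : ℝ, 0 < c → ∀ x ∈ E, c • x ∈ E) (hx : x ∈ E) (hs : 0 < s) (hst : s < t)
    (ha : a ∈ E) {A : Set (EuclideanSpace ℝ (Fin n))} (hA : MeasurableSet A) :
    ∫⁻ b in A ∩ E, ENNReal.ofReal (invertedDensity α p x s t a b) =
      backwardProb E p x (1 / t) (1 / s) ((fun y => t ^ α • y) ⁻¹' A) ((s ^ α)⁻¹ • a) := by
  have ht : 0 < t := hs.trans hst
  have hc : 0 < t ^ α := by positivity
  have hc' : 0 < (t ^ α)⁻¹ := by positivity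
  set c := t ^ α with hcdef
  set z := (s ^ α)⁻¹ • a with hz
  have hmeas : Measurable fun y => eDensity E p (1 / t) x y * eDensity E p (1 / s - 1 / t) y z :=
    ((hm _ (by positivity)).of_uncurry_left).mul (hm _ (one_div_sub_pos hs hst)).of_uncurry_right
  set g : EuclideanSpace ℝ (Fin n) → ℝ≥0∞ := fun y =>
    eDensity E p (1 / t) x y * eDensity E p (1 / s - 1 / t) y z * (eDensity E p (1 / s) x z)⁻¹
    with hg
  have hgm : Measurable g := hmeas.mul_const _
  have hpre : MeasurableSet ((fun y => c • y) ⁻¹' A) := (measurable_const_smul c) hA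
  have e1 : ∫⁻ b in A ∩ E, ENNReal.ofReal (invertedDensity α p x s t a b) =
      ENNReal.ofReal (c ^ n)⁻¹ * ∫⁻ b, A.indicator (fun b => g (c⁻¹ • b)) b := by
    have hgm' : Measurable fun b => g (c⁻¹ • b) := hgm.comp (measurable_const_smul _)
    rw [← lintegral_indicator (hA.inter hE), ← lintegral_const_mul _ (hgm'.indicator hA)]
    refine lintegral_congr fun b => ?_
    by_cases hbA : b ∈ A
    · rw [indicator_of_mem hbA]
      by_cases hbE : b ∈ E
      · rw [indicator_of_mem (show b ∈ A ∩ E from ⟨hbA, hbE⟩),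
          ofReal_invertedDensity hp hcone hx hs hst ha hbE]
      · rw [indicator_of_notMem (fun h => hbE h.2)]
        have : c⁻¹ • b ∉ E := fun h => hbE ((smul_mem_iff_of_cone hcone hc').1 h)
        simp [hg, eDensity_of_notMem_right this]
    · rw [indicator_of_notMem hbA, indicator_of_notMem (fun h => hbA h.1), mul_zero]
  rw [e1, ← lintegral_comp_smul_eq hc, backwardProb, div_eq_mul_inv,
    ← lintegral_mul_const _ hmeas, ← lintegral_indicator hpre]
  refine lintegral_congr fun y => ?_
  by_cases hy : c • y ∈ A
  · rw [indicator_of_mem hy, indicator_of_mem (show y ∈ (fun y => c • y) ⁻¹' A from hy),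
      inv_smul_smul₀ hc.ne']
  · rw [indicator_of_notMem hy, indicator_of_notMem (show y ∉ (fun y => c • y) ⁻¹' A from hy)]

theorem lintegral_invertedDensity (hp : IsSemigroupDensity E p) (hE : MeasurableSet E)
    (hm : ∀ t, 0 < t → Measurable (Function.uncurry (eDensity E p t)))
    (hcone : ∀ c : ℝ, 0 < c → ∀ x ∈ E, c • x ∈ E) (hx : x ∈ E) (hs : 0 < s) (hst : s < t)
    (ha : a ∈ E) : ∫⁻ b in E, ENNReal.ofReal (invertedDensity α p x s t a b) = 1 := by
  have ht : 0 < t := hs.trans hst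
  have h := setLIntegral_invertedDensity (α := α) hp hE hm hcone hx hs hst ha MeasurableSet.univ
  have ha' : (s ^ α)⁻¹ • a ∈ E := hcone _ (by positivity) _ ha
  rw [univ_inter] at h
  rw [h, preimage_univ, backwardProb, Measure.restrict_univ,
    hp.lintegral_eDensity_mul hE (by positivity) (one_div_sub_pos hs hst) hx,
    add_sub_cancel, eDensity_of_mem hx ha']
  exact ENNReal.div_self
    (ENNReal.ofReal_pos.2 (hp.pos (1 / s) (by positivity) x hx _ ha')).ne' ENNReal.ofReal_ne_top

/-- The factor `p_{1/t}(x, ·)` at the intermediate point cancels. What remains is Chapman–Kolmogorov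
for `p` in reversed order, from the point of `b` to that of `a`. -/
theorem lintegral_invertedDensity_mul (hp : IsSemigroupDensity E p) (hE : MeasurableSet E)
    (hm : ∀ t, 0 < t → Measurable (Function.uncurry (eDensity E p t)))
    (hcone : ∀ c : ℝ, 0 < c → ∀ x ∈ E, c • x ∈ E) (hx : x ∈ E) (hs : 0 < s) (hst : s < t)
    (htu : t < u) (ha : a ∈ E) (hb : b ∈ E) :
    ∫⁻ c in E, ENNReal.ofReal (invertedDensity α p x s t a c) *
        ENNReal.ofReal (invertedDensity α p x t u c b) =
      ENNReal.ofReal (invertedDensity α p x s u a b) := by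
  have ht : 0 < t := hs.trans hst
  have hu : 0 < u := ht.trans htu
  have hst' := one_div_sub_pos hs hst
  have htu' := one_div_sub_pos ht htu
  have hc : 0 < t ^ α := by positivity
  have hc' : 0 < (t ^ α)⁻¹ := by positivity
  set z := (s ^ α)⁻¹ • a with hz
  set w := (u ^ α)⁻¹ • b with hw
  have hzE : z ∈ E := hcone _ (by positivity) _ ha
  have hwE : w ∈ E := hcone _ (by positivity) _ hb
  have hpw := hp.pos (1 / u) (by positivity) x hx w hwE
  have hpz := hp.pos (1 / s) (by positivity) x hx z hzE
  set C : ℝ := u ^ (-(n * α)) * p (1 / u) x w / p (1 / s) x z with hC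
  have hCpos : 0 < C := by positivity
  set g : EuclideanSpace ℝ (Fin n) → ℝ≥0∞ := fun y =>
    eDensity E p (1 / t - 1 / u) w y * eDensity E p (1 / s - 1 / t) y z with hg
  have hgm : Measurable g := (hm _ htu').of_uncurry_left.mul (hm _ hst').of_uncurry_right
  have e1 : ∫⁻ c in E, ENNReal.ofReal (invertedDensity α p x s t a c) *
        ENNReal.ofReal (invertedDensity α p x t u c b) =
      ENNReal.ofReal C * (ENNReal.ofReal ((t ^ α) ^ n)⁻¹ * ∫⁻ c, g ((t ^ α)⁻¹ • c)) := by
    have hgm' : Measurable fun c => g ((t ^ α)⁻¹ • c) := hgm.comp (measurable_const_smul _)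
    rw [← lintegral_const_mul _ hgm', ← lintegral_const_mul _ (hgm'.const_mul _),
      ← lintegral_indicator hE]
    refine lintegral_congr fun c => ?_
    by_cases hcE : c ∈ E
    · have hyE : (t ^ α)⁻¹ • c ∈ E := hcone _ hc' _ hcE
      have h1 := hp.pos (1 / t) (by positivity) x hx _ hyE
      have h2 := hp.pos _ htu' _ hwE _ hyE
      have h3 := hp.pos _ hst' _ hyE _ hzE
      rw [indicator_of_mem hcE, ← ENNReal.ofReal_mul
        (invertedDensity_pos hp hcone hx hs hst ha hcE).le]
      simp only [hg]
      rw [eDensity_of_mem hwE hyE, eDensity_of_mem hyE hzE, ← ENNReal.ofReal_mul h2.le,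
        ← ENNReal.ofReal_mul (by positivity), ← ENNReal.ofReal_mul hCpos.le,
        invertedDensity, invertedDensity, rpow_neg_mul_eq ht]
      congr 1
      simp only [hC]
      rw [← hz, ← hw]
      have key : ∀ k v d₁ d₂ d₃ d₄ d₅ : ℝ, d₁ ≠ 0 →
          k * (d₁ * d₂) / d₃ * (v * (d₄ * d₅) / d₁) = v * d₄ / d₃ * (k * (d₅ * d₂)) := by
        intros
        field_simp
      exact key _ _ _ _ _ _ _ h1.ne'
    · have hyE : (t ^ α)⁻¹ • c ∉ E := fun h => hcE ((smul_mem_iff_of_cone hcone hc').1 h)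
      rw [indicator_of_notMem hcE]
      simp [hg, eDensity_of_notMem_left hyE]
  have e2 := lintegral_comp_smul_eq hc fun c => g ((t ^ α)⁻¹ • c)
  simp only [inv_smul_smul₀ hc.ne'] at e2
  rw [e1, ← e2, hp.lintegral_eDensity_mul hE htu' hst' hwE, eDensity_of_mem hwE hzE,
    ← ENNReal.ofReal_mul hCpos.le, invertedDensity]
  congr 1
  rw [show 1 / t - 1 / u + (1 / s - 1 / t) = 1 / s - 1 / u by ring, hC]
  ring

/-- The inverted densities always form a time-inhomogeneous evolution; if they depend on the
increment alone, reading it from time `1` gives a semigroup. -/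
theorem isSemigroupDensity_of_invertedDensity (hp : IsSemigroupDensity E p) (hE : MeasurableSet E)
    (hm : ∀ t, 0 < t → Measurable (Function.uncurry (eDensity E p t)))
    (hcone : ∀ c : ℝ, 0 < c → ∀ x ∈ E, c • x ∈ E) (hx : x ∈ E)
    (hq : ∀ s t, 0 < s → s < t → ∀ a ∈ E, ∀ b ∈ E,
      invertedDensity α p x s t a b = q (t - s) a b) : IsSemigroupDensity E q := by
  have hq' : ∀ s t, 0 < s → 0 < t → ∀ a ∈ E, ∀ b ∈ E,
      q t a b = invertedDensity α p x s (s + t) a b := by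
    intro s t hs ht a ha b hb
    rw [hq s (s + t) hs (by linarith) a ha b hb, add_sub_cancel_left]
  refine ⟨fun t ht a ha b hb => ?_, fun t ht a ha => ?_, fun s t hs ht a ha b hb => ?_⟩
  · rw [hq' 1 t one_pos ht a ha b hb]
    exact invertedDensity_pos hp hcone hx one_pos (by linarith) ha hb
  · rw [← lintegral_invertedDensity (α := α) hp hE hm hcone hx one_pos
      (show 1 < 1 + t by linarith) ha]
    refine setLIntegral_congr_fun hE fun b hb => ?_
    simp only [hq' 1 t one_pos ht a ha b hb]
  · rw [hq' 1 (s + t) one_pos (by linarith) a ha b hb, ← add_assoc,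
      ← lintegral_invertedDensity_mul hp hE hm hcone hx one_pos (show 1 < 1 + s by linarith)
        (show 1 + s < 1 + s + t by linarith) ha hb]
    refine setLIntegral_congr_fun hE fun c hc => ?_
    simp only [hq' 1 s one_pos hs a ha c hc, hq' (1 + s) t (by linarith) ht c hc b hb]

end Inversion

/-! ### Markov property of the inverted process -/

section InvertedProcess

open scoped ENNReal

variable {n : ℕ} {α : ℝ} {E : Set (EuclideanSpace ℝ (Fin n))} {Ω : Type*}
  {X : ℝ → Ω → EuclideanSpace ℝ (Fin n)}
  {p q : ℝ → EuclideanSpace ℝ (Fin n) → EuclideanSpace ℝ (Fin n) → ℝ}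
  {x : EuclideanSpace ℝ (Fin n)} {s t : ℝ}

/-- Times `u ≤ s` of the inverted process correspond to times `1 / u ≥ 1 / s` of `X`, so
reversed-time conditioning applies to its past. -/
theorem past_timeInverted_le :
    past (Ioi 0) (timeInverted α X) s ≤
      ⨆ u ∈ Ici (1 / s), MeasurableSpace.comap (X u) inferInstance := by
  refine iSup₂_le fun u hu => ?_
  have hu0 : 0 < u := hu.1
  refine le_trans ?_ (le_iSup₂_of_le
    (f := fun u (_ : u ∈ Ici (1 / s)) => MeasurableSpace.comap (X u) inferInstance)
    (1 / u) (one_div_le_one_div_of_le hu0 hu.2) le_rfl)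
  rw [show timeInverted α X u = (fun y => u ^ α • y) ∘ X (1 / u) from rfl,
    ← MeasurableSpace.comap_comp]
  exact MeasurableSpace.comap_mono (measurable_const_smul _).comap_le

variable [MeasurableSpace Ω] {P : EuclideanSpace ℝ (Fin n) → Measure Ω}

theorem IsMarkovProcess.measurable_timeInverted (hX : IsMarkovProcess E X P p) (hx : x ∈ E)
    (ht : 0 < t) : Measurable (timeInverted α X t) :=
  ((hX.markov x hx).measurable (1 / t) (mem_Ici.2 (by positivity))).const_smul (t ^ α)

theorem IsMarkovProcess.condProb_timeInverted (hX : IsMarkovProcess E X P p)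
    (hE : MeasurableSet E)
    (hm : ∀ t, 0 < t → Measurable (Function.uncurry (eDensity E p t))) (hx : x ∈ E)
    (hs : 0 < s) (hst : s < t) {A : Set (EuclideanSpace ℝ (Fin n))} (hA : MeasurableSet A) :
    (P x)⟦timeInverted α X t ⁻¹' A | past (Ioi 0) (timeInverted α X) s⟧ =ᵐ[P x] fun ω =>
      (backwardProb E p x (1 / t) (1 / s) ((fun y => t ^ α • y) ⁻¹' A)
        ((s ^ α)⁻¹ • timeInverted α X s ω)).toReal := by
  have := hX.prob x hx
  have ht : 0 < t := hs.trans hst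
  have hlt : 1 / t < 1 / s := one_div_lt_one_div_of_lt hs hst
  refine condProb_ae_eq_toReal
    (past_le (fun u hu => hX.measurable_timeInverted hx hu) s)
    (hX.measurable_timeInverted hx ht hA) ?_ fun F hF => ?_
  · exact ((measurable_backwardProb hm x (by positivity) hlt _).comp
      (measurable_const_smul _)).comp (measurable_past (mem_Ioi.2 hs) le_rfl)
  · have h := hX.measure_inter_future hE hm hx (one_div_pos.2 ht) hlt
      ((measurable_const_smul (t ^ α)) hA) (past_timeInverted_le F hF)
    have e : ∀ ω, (s ^ α)⁻¹ • timeInverted α X s ω = X (1 / s) ω := fun ω =>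
      inv_smul_smul₀ (by positivity) _
    simp only [e]
    exact h

theorem IsMarkovProcess.ae_timeInverted_mem (hX : IsMarkovProcess E X P p)
    (hE : MeasurableSet E)
    (hm : ∀ t, 0 < t → Measurable (Function.uncurry (eDensity E p t)))
    (hcone : ∀ c : ℝ, 0 < c → ∀ x ∈ E, c • x ∈ E) (hx : x ∈ E) (hs : 0 < s) :
    ∀ᵐ ω ∂(P x), timeInverted α X s ω ∈ E := by
  filter_upwards [hX.ae_mem hE hm hx (one_div_pos.2 hs).le] with ω hω
  exact hcone _ (by positivity) _ hω

theorem IsMarkovProcess.isMarkovWith_timeInverted (hX : IsMarkovProcess E X P p)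
    (hE : MeasurableSet E)
    (hm : ∀ t, 0 < t → Measurable (Function.uncurry (eDensity E p t)))
    (hcone : ∀ c : ℝ, 0 < c → ∀ x ∈ E, c • x ∈ E) (hx : x ∈ E)
    (hq : ∀ s t, 0 < s → s < t → ∀ a ∈ E, ∀ b ∈ E,
      invertedDensity α p x s t a b = q (t - s) a b) :
    IsMarkovWith (Ioi 0) (timeInverted α X) (P x) (densityMeasure E q) := by
  refine ⟨fun t ht => hX.measurable_timeInverted hx ht, fun s hs t ht hst A hA => ?_⟩
  filter_upwards [hX.condProb_timeInverted (α := α) hE hm hx hs hst hA,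
    hX.ae_timeInverted_mem (α := α) hE hm hcone hx hs] with ω h1 h2
  refine h1.trans ?_
  rw [← setLIntegral_invertedDensity hX.semigroup hE hm hcone hx hs hst h2 hA,
    measureReal_def, densityMeasure, withDensity_apply _ hA, Measure.restrict_restrict hA]
  congr 1
  refine setLIntegral_congr_fun (hA.inter hE) fun b hb => ?_
  simp only [hq s t hs hst _ h2 b hb.2]

theorem IsMarkovProcess.isHomogeneousMarkov_timeInverted (hX : IsMarkovProcess E X P p)
    (hE : MeasurableSet E)
    (hm : ∀ t, 0 < t → Measurable (Function.uncurry (eDensity E p t)))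
    (hcone : ∀ c : ℝ, 0 < c → ∀ x ∈ E, c • x ∈ E) (hx : x ∈ E)
    (hq : ∀ s t, 0 < s → s < t → ∀ a ∈ E, ∀ b ∈ E,
      invertedDensity α p x s t a b = q (t - s) a b)
    (hqm : ∀ t, 0 < t → Measurable (Function.uncurry (eDensity E q t))) :
    IsHomogeneousMarkov (Ioi 0) (timeInverted α X) (P x) := by
  have hsg := isSemigroupDensity_of_invertedDensity hX.semigroup hE hm hcone hx hq
  have hM := hX.isMarkovWith_timeInverted hE hm hcone hx hq
  refine ⟨densityKernel hE q, fun r hr => isMarkovKernel_densityKernel hE hsg hr (hqm r hr),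
    fun r s hr hs => densityKernel_add hE hsg hqm hr hs, hM.measurable,
    fun s hs t ht hst A hA => ?_⟩
  filter_upwards [hM.condProb s hs t ht hst A hA,
    hX.ae_timeInverted_mem (α := α) hE hm hcone hx hs] with ω h1 h2
  refine h1.trans ?_
  rw [densityMeasure_eq_withDensity hE h2,
    densityKernel_of_mem hE (hqm _ (sub_pos.2 hst)) h2]

/-- What holds almost surely for the inverted process at a fixed time holds almost everywhere. -/
theorem IsMarkovProcess.ae_of_ae_timeInverted (hX : IsMarkovProcess E X P p)
    (hE : MeasurableSet E)
    (hm : ∀ t, 0 < t → Measurable (Function.uncurry (eDensity E p t)))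
    (hcone : ∀ c : ℝ, 0 < c → ∀ x ∈ E, c • x ∈ E) (hx : x ∈ E) (hs : 0 < s)
    {φ : EuclideanSpace ℝ (Fin n) → Prop} (hφ : MeasurableSet {a | φ a})
    (h : ∀ᵐ ω ∂(P x), φ (timeInverted α X s ω)) : ∀ᵐ a, a ∈ E → φ a := by
  have hc : 0 < s ^ α := by positivity
  have hXs := (hX.markov x hx).measurable (1 / s) (mem_Ici.2 (by positivity))
  have h1 : ∀ᵐ y ∂((P x).map (X (1 / s))), φ (s ^ α • y) :=
    (ae_map_iff hXs.aemeasurable ((measurable_const_smul (s ^ α)) hφ)).2 h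
  rw [hX.map_eq hE hm hx (by positivity), ae_withDensity_iff
    (hm _ (by positivity)).of_uncurry_left] at h1
  have h2 := Measure.addHaar_preimage_smul (volume : Measure (EuclideanSpace ℝ (Fin n)))
    (inv_ne_zero hc.ne') {y | ¬(eDensity E p (1 / s) x y ≠ 0 → φ (s ^ α • y))}
  rw [ae_iff.1 h1, mul_zero] at h2
  refine measure_mono_null (fun a ha => ?_) h2
  simp only [mem_compl_iff, mem_ofPred_eq, mem_preimage, Classical.not_imp] at ha ⊢
  have ha' := hcone _ (inv_pos.2 hc) _ ha.1
  refine ⟨?_, by rw [smul_inv_smul₀ hc.ne']; exact ha.2⟩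
  rw [eDensity_of_mem hx ha']
  exact (ENNReal.ofReal_pos.2 (hX.semigroup.pos _ (by positivity) x hx _ ha')).ne'

end InvertedProcess

/-! ### From homogeneity in law to pointwise homogeneity -/

section Regularity

open scoped ENNReal

variable {n : ℕ} {α : ℝ} {E : Set (EuclideanSpace ℝ (Fin n))}
  {p q : ℝ → EuclideanSpace ℝ (Fin n) → EuclideanSpace ℝ (Fin n) → ℝ}
  {x a b : EuclideanSpace ℝ (Fin n)} {s t : ℝ}

theorem measurable_eDensity (hE : IsOpen E)
    (h : ContinuousOn (fun z : EuclideanSpace ℝ (Fin n) × EuclideanSpace ℝ (Fin n) =>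
      p t z.1 z.2) (E ×ˢ E)) : Measurable (Function.uncurry (eDensity E p t)) := by
  classical
  have e : Function.uncurry (eDensity E p t) = (E ×ˢ E).piecewise
      (fun z => ENNReal.ofReal (p t z.1 z.2)) (fun _ => 0) := by
    funext z
    by_cases hz : z ∈ E ×ˢ E
    · rw [piecewise_eq_of_mem _ _ _ hz]
      exact eDensity_of_mem hz.1 hz.2
    · rw [piecewise_eq_of_notMem _ _ _ hz]
      exact indicator_of_notMem (f := fun z => ENNReal.ofReal (p t z.1 z.2)) hz
  rw [e]
  exact ContinuousOn.measurable_piecewise (ENNReal.continuous_ofReal.comp_continuousOn h)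
    continuousOn_const (hE.prod hE).measurableSet

theorem continuousOn_density
    (hp : ContinuousOn (fun z : ℝ × EuclideanSpace ℝ (Fin n) × EuclideanSpace ℝ (Fin n) =>
      p z.1 z.2.1 z.2.2) (Ioi 0 ×ˢ E ×ˢ E)) (ht : 0 < t) :
    ContinuousOn (fun z : EuclideanSpace ℝ (Fin n) × EuclideanSpace ℝ (Fin n) =>
      p t z.1 z.2) (E ×ˢ E) :=
  hp.comp (f := fun z : EuclideanSpace ℝ (Fin n) × EuclideanSpace ℝ (Fin n) => (t, z.1, z.2))
    (by fun_prop) fun _ hz => ⟨ht, hz.1, hz.2⟩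

theorem continuousOn_invertedDensity (hsg : IsSemigroupDensity E p)
    (hp : ContinuousOn (fun z : ℝ × EuclideanSpace ℝ (Fin n) × EuclideanSpace ℝ (Fin n) =>
      p z.1 z.2.1 z.2.2) (Ioi 0 ×ˢ E ×ˢ E))
    (hcone : ∀ c : ℝ, 0 < c → ∀ x ∈ E, c • x ∈ E) (hx : x ∈ E) (hs : 0 < s) (hst : s < t) :
    ContinuousOn (fun z : EuclideanSpace ℝ (Fin n) × EuclideanSpace ℝ (Fin n) =>
      invertedDensity α p x s t z.1 z.2) (E ×ˢ E) := by
  have ht : 0 < t := hs.trans hst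
  have hs' : 0 < (s ^ α)⁻¹ := by positivity
  have ht' : 0 < (t ^ α)⁻¹ := by positivity
  have h1 := hp.comp (f := fun z : EuclideanSpace ℝ (Fin n) × EuclideanSpace ℝ (Fin n) =>
    (1 / t, x, (t ^ α)⁻¹ • z.2)) (s := E ×ˢ E) (by fun_prop)
    fun z hz => ⟨one_div_pos.2 ht, hx, hcone _ ht' _ hz.2⟩
  have h2 := hp.comp (f := fun z : EuclideanSpace ℝ (Fin n) × EuclideanSpace ℝ (Fin n) =>
    (1 / s - 1 / t, (t ^ α)⁻¹ • z.2, (s ^ α)⁻¹ • z.1)) (s := E ×ˢ E) (by fun_prop)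
    fun z hz => ⟨one_div_sub_pos hs hst, hcone _ ht' _ hz.2, hcone _ hs' _ hz.1⟩
  have h3 := hp.comp (f := fun z : EuclideanSpace ℝ (Fin n) × EuclideanSpace ℝ (Fin n) =>
    (1 / s, x, (s ^ α)⁻¹ • z.1)) (s := E ×ˢ E) (by fun_prop)
    fun z hz => ⟨one_div_pos.2 hs, hx, hcone _ hs' _ hz.1⟩
  exact (continuousOn_const.mul (h1.mul h2)).div h3 fun z hz =>
    (hsg.pos _ (one_div_pos.2 hs) _ hx _ (hcone _ hs' _ hz.1)).ne'

theorem measurable_eDensity_of_invertedDensity (hE : IsOpen E) (hsg : IsSemigroupDensity E p)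
    (hp : ContinuousOn (fun z : ℝ × EuclideanSpace ℝ (Fin n) × EuclideanSpace ℝ (Fin n) =>
      p z.1 z.2.1 z.2.2) (Ioi 0 ×ˢ E ×ˢ E))
    (hcone : ∀ c : ℝ, 0 < c → ∀ x ∈ E, c • x ∈ E) (hx : x ∈ E)
    (hq : ∀ s t, 0 < s → s < t → ∀ a ∈ E, ∀ b ∈ E,
      invertedDensity α p x s t a b = q (t - s) a b) (ht : 0 < t) :
    Measurable (Function.uncurry (eDensity E q t)) := by
  refine measurable_eDensity hE ((continuousOn_invertedDensity (α := α) hsg hp hcone hx one_pos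
    (show 1 < 1 + t by linarith)).congr fun z hz => ?_)
  simp only [hq 1 (1 + t) one_pos (by linarith) z.1 hz.1 z.2 hz.2, add_sub_cancel_left]

/-- If the inverted process is homogeneous, its transition density depends on the time increment
only. -/
theorem invertedDensity_eq_of_isHomogeneousMarkov {Ω : Type*} [MeasurableSpace Ω]
    {X : ℝ → Ω → EuclideanSpace ℝ (Fin n)} {P : EuclideanSpace ℝ (Fin n) → Measure Ω}
    (hE : IsOpen E) (hX : IsMarkovProcess E X P p)
    (hp : ContinuousOn (fun z : ℝ × EuclideanSpace ℝ (Fin n) × EuclideanSpace ℝ (Fin n) =>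
      p z.1 z.2.1 z.2.2) (Ioi 0 ×ˢ E ×ˢ E))
    (hcone : ∀ c : ℝ, 0 < c → ∀ x ∈ E, c • x ∈ E) (hx : x ∈ E)
    (hH : IsHomogeneousMarkov (Ioi 0) (timeInverted α X) (P x))
    {s' t' : ℝ} (hs : 0 < s) (hst : s < t) (hs' : 0 < s') (hst' : s' < t')
    (hd : t - s = t' - s') (ha : a ∈ E) (hb : b ∈ E) :
    invertedDensity α p x s t a b = invertedDensity α p x s' t' a b := by
  obtain ⟨Q, -, -, hQ⟩ := hH
  have hm : ∀ t, 0 < t → Measurable (Function.uncurry (eDensity E p t)) := fun t ht =>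
    measurable_eDensity hE (continuousOn_density hp ht)
  have hsg := hX.semigroup
  have hEm := hE.measurableSet
  -- Two versions of one conditional probability coincide almost surely, hence for almost every `a ∈
  -- E`, because the process has a positive density on `E`.
  have hae : ∀ s t, 0 < s → s < t → ∀ A : Set (EuclideanSpace ℝ (Fin n)), MeasurableSet A →
      ∀ᵐ a, a ∈ E → (∫⁻ b in A ∩ E, ENNReal.ofReal (invertedDensity α p x s t a b)).toReal =
        (Q (t - s) a).real A := by
    intro s t hs hst A hA
    have hmb : Measurable fun a => (backwardProb E p x (1 / t) (1 / s)
        ((fun y => t ^ α • y) ⁻¹' A) ((s ^ α)⁻¹ • a)).toReal :=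
      ((measurable_backwardProb hm x (one_div_pos.2 (hs.trans hst))
        (one_div_lt_one_div_of_lt hs hst) _).comp (measurable_const_smul _)).ennreal_toReal
    have hmQ : Measurable fun a => (Q (t - s) a).real A :=
      (Kernel.measurable_coe _ hA).ennreal_toReal
    have h1 := hX.condProb_timeInverted (α := α) hEm hm hx hs hst hA
    have h2 := hQ.condProb s hs t (hs.trans hst) hst A hA
    have h3 := hX.ae_of_ae_timeInverted (α := α) hEm hm hcone hx hs
      (measurableSet_eq_fun hmb hmQ) (h1.symm.trans h2)
    filter_upwards [h3] with a h ha
    rw [setLIntegral_invertedDensity hsg hEm hm hcone hx hs hst ha hA]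
    exact h ha
  -- A strict inequality at `(a, b)` persists on a product neighbourhood `U ×ˢ W`. Integrating over
  -- `W` keeps it strict for each `u ∈ U`, whereas for almost every `u` both integrals equal the
  -- mass of `W` under the same kernel.
  have hnot : ∀ s t s' t', 0 < s → s < t → 0 < s' → s' < t' → t - s = t' - s' →
      ¬ invertedDensity α p x s t a b < invertedDensity α p x s' t' a b := by
    intro s t s' t' hs hst hs' hst' hd hlt
    have hc := continuousOn_invertedDensity (α := α) hsg hp hcone hx hs hst
    have hc' := continuousOn_invertedDensity (α := α) hsg hp hcone hx hs' hst'
    have hO := (hc'.sub hc).isOpen_inter_preimage (hE.prod hE) (isOpen_Ioi (a := (0 : ℝ)))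
    obtain ⟨U, W, hU, hW, haU, hbW, hUW⟩ := isOpen_prod_iff.1 hO a b
      ⟨⟨ha, hb⟩, by simpa using hlt⟩
    have hUE : U ⊆ E := fun u hu => (hUW (mk_mem_prod hu hbW)).1.1
    have hWE : W ⊆ E := fun w hw => (hUW (mk_mem_prod haU hw)).1.2
    have hae1 := hae s t hs hst W hW.measurableSet
    have hae2 := hae s' t' hs' hst' W hW.measurableSet
    rw [← hd] at hae2
    have hUpos : volume U ≠ 0 := (hU.measure_pos volume ⟨a, haU⟩).ne'
    obtain ⟨u, huU, h1, h2⟩ : ∃ u ∈ U,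
        (u ∈ E → (∫⁻ b in W ∩ E, ENNReal.ofReal (invertedDensity α p x s t u b)).toReal =
          (Q (t - s) u).real W) ∧
        (u ∈ E → (∫⁻ b in W ∩ E, ENNReal.ofReal (invertedDensity α p x s' t' u b)).toReal =
          (Q (t - s) u).real W) := by
      by_contra! hcon
      refine hUpos (measure_mono_null (fun u hu => ?_) (ae_iff.1 (hae1.and hae2)))
      intro h
      obtain ⟨h1, h2⟩ := hcon u hu h.1
      exact h2 (h.2 h1)
    have huE := hUE huU
    have hfin : ∀ s t, 0 < s → s < t →
        ∫⁻ b in W, ENNReal.ofReal (invertedDensity α p x s t u b) ≠ ∞ := by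
      intro s t hs hst
      refine ((lintegral_mono_set hWE).trans_lt ?_).ne
      rw [lintegral_invertedDensity hsg hEm hm hcone hx hs hst huE]
      exact ENNReal.one_lt_top
    rw [inter_eq_self_of_subset_left hWE] at h1 h2
    have heq := (h1 huE).trans (h2 huE).symm
    rw [ENNReal.toReal_eq_toReal_iff' (hfin s t hs hst) (hfin s' t' hs' hst')] at heq
    refine (lintegral_strict_mono ?_ ?_ (hfin s t hs hst) ?_).ne heq
    · rw [Ne, Measure.restrict_eq_zero]
      exact (hW.measure_pos volume ⟨b, hbW⟩).ne'
    · refine ContinuousOn.aemeasurable ?_ hW.measurableSet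
      refine ENNReal.continuous_ofReal.comp_continuousOn
        (hc'.comp (f := fun b => (u, b)) (by fun_prop) fun w hw => ⟨huE, hWE hw⟩)
    · refine (ae_restrict_iff' hW.measurableSet).2 (ae_of_all _ fun w hw => ?_)
      have h := (hUW (mk_mem_prod huU hw)).2
      simp only [mem_preimage, mem_Ioi] at h
      exact (ENNReal.ofReal_lt_ofReal_iff
        (invertedDensity_pos hsg hcone hx hs' hst' huE (hWE hw))).2 (by simpa using h)
  exact le_antisymm (not_lt.1 (hnot s' t' s t hs' hst' hs hst hd.symm))
    (not_lt.1 (hnot s t s' t' hs hst hs' hst' hd))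

end Regularity

/-! ### Computation with the explicit form -/

section Form

variable {n : ℕ} {α : ℝ} {E : Set (EuclideanSpace ℝ (Fin n))}
  {Φ : EuclideanSpace ℝ (Fin n) → EuclideanSpace ℝ (Fin n) → ℝ}
  {θ ρ h : EuclideanSpace ℝ (Fin n) → ℝ} {ν : ℝ}
  {p p₀ : ℝ → EuclideanSpace ℝ (Fin n) → EuclideanSpace ℝ (Fin n) → ℝ}
  {x a b : EuclideanSpace ℝ (Fin n)} {s t : ℝ}

/-- The scaling of `Φ` moves both dilations to the second argument, the degree of `ρ` turns them
into `1 / t`, and `θ` contributes the power with exponent `-(β * α / 2)`. -/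
theorem HasInversionForm.density_eq (hα : 0 < α) (hf : HasInversionForm E α Φ θ ρ p₀)
    (hcone : ∀ c : ℝ, 0 < c → ∀ x ∈ E, c • x ∈ E) {β : ℝ}
    (hβ : ∀ c : ℝ, 0 < c → ∀ y ∈ E, θ (c • y) = c ^ β * θ y) (t : ℝ) (ht : 0 < t)
    (x : EuclideanSpace ℝ (Fin n)) (hx : x ∈ E) (y : EuclideanSpace ℝ (Fin n)) (hy : y ∈ E) :
    p₀ t x y = t ^ (-((n + β) * α / 2)) *
      Φ x ((t ^ α)⁻¹ • y) * θ y * Real.exp ((ρ x + ρ y) / t) := by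
  have hc : 0 < (t ^ (α / 2))⁻¹ := by positivity
  have e1 : (t ^ (α / 2))⁻¹ * (t ^ (α / 2))⁻¹ = (t ^ α)⁻¹ := by
    rw [← mul_inv, ← Real.rpow_add ht, add_halves]
  have e2 : (t ^ (α / 2))⁻¹ ^ (2 / α) = t⁻¹ := by
    rw [← Real.rpow_neg ht.le, ← Real.rpow_mul ht.le, ← Real.rpow_neg_one]
    congr 1
    field_simp
  have e3 : (t ^ (α / 2))⁻¹ ^ β = t ^ (-(β * α / 2)) := by
    rw [← Real.rpow_neg ht.le, ← Real.rpow_mul ht.le]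
    congr 1
    ring
  rw [hf.eq t ht x hx y hy, hf.kernel_scaling _ hc x hx _ (hcone _ hc y hy), smul_smul, e1,
    hf.rho_homogeneous _ hc x hx, hf.rho_homogeneous _ hc y hy, hβ _ hc y hy, e2, e3,
    show -((n + β) * α / 2) = -(n * α / 2) + -(β * α / 2) by ring, Real.rpow_add ht,
    show t⁻¹ * ρ x + t⁻¹ * ρ y = (ρ x + ρ y) / t by field_simp]
  ring

/-- The factors `h` telescope, `ν` cancels since `1 / t + (1 / s - 1 / t) = 1 / s`, and the powers
of `s` and `t` cancel. Inversion exchanges the arguments of the last `Φ`, so symmetry of `Φ` is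
needed to recognise `p₀ (t - s) a b`, but not for homogeneity. -/
theorem invertedDensity_eq_of_form (hα : 0 < α) (hsg : IsSemigroupDensity E p)
    (hcone : ∀ c : ℝ, 0 < c → ∀ x ∈ E, c • x ∈ E)
    (hf : HasInversionForm E α Φ θ ρ p₀) (hh : IsHTransform E h ν p₀ p) {β : ℝ}
    (hβ : ∀ c : ℝ, 0 < c → ∀ y ∈ E, θ (c • y) = c ^ β * θ y)
    (hx : x ∈ E) (hs : 0 < s) (hst : s < t) (ha : a ∈ E) (hb : b ∈ E) :
    invertedDensity α p x s t a b = Φ x b / Φ x a * Real.exp ((t - s) * ρ x) *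
      ((t - s) ^ (-((n + β) * α / 2)) * Φ b (((t - s) ^ α)⁻¹ • a) * θ b *
        Real.exp ((ρ a + ρ b) / (t - s))) := by
  have ht : 0 < t := hs.trans hst
  have hr : 0 < t - s := sub_pos.2 hst
  have hτ := one_div_sub_pos hs hst
  have hs' : 0 < (s ^ α)⁻¹ := by positivity
  have ht' : 0 < (t ^ α)⁻¹ := by positivity
  have haE := hcone _ hs' _ ha
  have hbE := hcone _ ht' _ hb
  have hp₀ := hf.density_eq hα hcone hβ
  have hnz := (hsg.pos (1 / s) (one_div_pos.2 hs) x hx _ haE).ne'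
  have hρ : ∀ t, 0 < t → ∀ y ∈ E, ρ ((t ^ α)⁻¹ • y) = ρ y / t ^ 2 := by
    intro t ht y hy
    rw [hf.rho_homogeneous _ (by positivity) y hy, ← Real.rpow_neg ht.le, ← Real.rpow_mul ht.le,
      show -α * (2 / α) = -(2 : ℕ) by field_simp; norm_num, Real.rpow_neg ht.le,
      Real.rpow_natCast]
    field_simp
  have hinv : ∀ t : ℝ, 0 < t → ((1 / t) ^ α)⁻¹ = t ^ α := by
    intro t ht
    rw [one_div, Real.inv_rpow ht.le, inv_inv]
  have hneg : ∀ t : ℝ, 0 < t → ∀ γ : ℝ, (1 / t) ^ (-γ) = t ^ γ := by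
    intro t ht γ
    rw [one_div, Real.inv_rpow ht.le, Real.rpow_neg ht.le, inv_inv]
  have hθt : (t ^ α)⁻¹ ^ β = t ^ (-(α * β)) := by
    rw [← Real.rpow_neg ht.le, ← Real.rpow_mul ht.le, neg_mul]
  have eτ : 1 / s - 1 / t = (t - s) / (s * t) := by field_simp
  have e1 : p (1 / t) x ((t ^ α)⁻¹ • b) = h ((t ^ α)⁻¹ • b) / h x * Real.exp (-ν * (1 / t)) *
      (t ^ ((n + β) * α / 2) * Φ x b * (t ^ (-(α * β)) * θ b) *
        Real.exp (t * ρ x + ρ b / t)) := by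
    rw [hh.eq _ (one_div_pos.2 ht) x hx _ hbE, hp₀ _ (one_div_pos.2 ht) x hx _ hbE, hinv t ht,
      smul_inv_smul₀ (by positivity), hβ _ ht' b hb, hρ t ht b hb, hneg t ht, hθt,
      show (ρ x + ρ b / t ^ 2) / (1 / t) = t * ρ x + ρ b / t by field_simp]
  have e2 : p (1 / s) x ((s ^ α)⁻¹ • a) = h ((s ^ α)⁻¹ • a) / h x * Real.exp (-ν * (1 / s)) *
      (s ^ ((n + β) * α / 2) * Φ x a * θ ((s ^ α)⁻¹ • a) *
        Real.exp (s * ρ x + ρ a / s)) := by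
    rw [hh.eq _ (one_div_pos.2 hs) x hx _ haE, hp₀ _ (one_div_pos.2 hs) x hx _ haE, hinv s hs,
      smul_inv_smul₀ (by positivity), hρ s hs a ha, hneg s hs,
      show (ρ x + ρ a / s ^ 2) / (1 / s) = s * ρ x + ρ a / s by field_simp]
  have e3 : p (1 / s - 1 / t) ((t ^ α)⁻¹ • b) ((s ^ α)⁻¹ • a) =
      h ((s ^ α)⁻¹ • a) / h ((t ^ α)⁻¹ • b) * Real.exp (-ν * (1 / s - 1 / t)) *
      ((t - s) ^ (-((n + β) * α / 2)) * s ^ ((n + β) * α / 2) * t ^ ((n + β) * α / 2) *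
        Φ b (((t - s) ^ α)⁻¹ • a) * θ ((s ^ α)⁻¹ • a) *
        Real.exp (ρ b * s / (t * (t - s)) + ρ a * t / (s * (t - s)))) := by
    have hsm : (t ^ α)⁻¹ • ((1 / s - 1 / t) ^ α)⁻¹ • (s ^ α)⁻¹ • a = ((t - s) ^ α)⁻¹ • a := by
      rw [smul_smul, smul_smul, eτ, Real.div_rpow hr.le (by positivity),
        Real.mul_rpow hs.le ht.le]
      congr 1
      field_simp
    rw [hh.eq _ hτ _ hbE _ haE, hp₀ _ hτ _ hbE _ haE,
      hf.kernel_scaling _ ht' b hb _ (hcone _ (by positivity) _ haE), hsm, hρ t ht b hb,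
      hρ s hs a ha,
      show (ρ b / t ^ 2 + ρ a / s ^ 2) / (1 / s - 1 / t) =
        ρ b * s / (t * (t - s)) + ρ a * t / (s * (t - s)) by rw [eτ]; field_simp,
      show (1 / s - 1 / t) ^ (-((n + β) * α / 2)) = (t - s) ^ (-((n + β) * α / 2)) *
        s ^ ((n + β) * α / 2) * t ^ ((n + β) * α / 2) by
        rw [eτ, Real.div_rpow hr.le (by positivity), Real.mul_rpow hs.le ht.le,
          Real.rpow_neg hs.le, Real.rpow_neg ht.le]
        field_simp]
  have hhx := (hh.pos x hx).ne'
  have hha := (hh.pos _ haE).ne'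
  have hhb := (hh.pos _ hbE).ne'
  -- No sign is assumed for `Φ` or `θ`; positivity of `p` excludes zeros of the factors in the
  -- denominator.
  have hΦ : Φ x a ≠ 0 := by
    intro h0; rw [e2, h0] at hnz; simp at hnz
  have hθ : θ ((s ^ α)⁻¹ • a) ≠ 0 := by
    intro h0; rw [e2, h0] at hnz; simp at hnz
  have hexp : Real.exp (-ν * (1 / t)) * Real.exp (t * ρ x + ρ b / t) *
      (Real.exp (-ν * (1 / s - 1 / t)) *
        Real.exp (ρ b * s / (t * (t - s)) + ρ a * t / (s * (t - s)))) =
      Real.exp ((t - s) * ρ x) * Real.exp ((ρ a + ρ b) / (t - s)) *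
      (Real.exp (-ν * (1 / s)) * Real.exp (s * ρ x + ρ a / s)) := by
    simp only [← Real.exp_add]
    congr 1
    field_simp
    ring
  have hpow : t ^ (-(n * α)) * (t ^ ((n + β) * α / 2) * t ^ (-(α * β)) *
      t ^ ((n + β) * α / 2)) = 1 := by
    simp only [← Real.rpow_add ht]
    rw [← Real.rpow_zero t]
    congr 1
    ring
  have hsne : s ^ ((n + β) * α / 2) ≠ 0 := by positivity
  have hexpne : Real.exp (-ν * (1 / s)) * Real.exp (s * ρ x + ρ a / s) ≠ 0 := by positivity
  -- With all factors as free variables only two relations are needed: `h8` for the powers of `t`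
  -- and `h9` for the exponentials.
  have key : ∀ T₀ T₁ T₂ s₁ r₁ hx ha hb w₁ w₂ w₃ v₁ v₂ v₃ u₁ u₂ f₁ f₂ f₃ g₁ g₂ : ℝ,
      hx ≠ 0 → ha ≠ 0 → hb ≠ 0 → f₂ ≠ 0 → g₁ ≠ 0 → s₁ ≠ 0 → w₂ * v₂ ≠ 0 →
      T₀ * (T₁ * T₂ * T₁) = 1 → w₁ * v₁ * (w₃ * v₃) = u₁ * u₂ * (w₂ * v₂) →
      T₀ * (hb / hx * w₁ * (T₁ * f₁ * (T₂ * g₂) * v₁) *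
        (ha / hb * w₃ * (r₁ * s₁ * T₁ * f₃ * g₁ * v₃))) /
        (ha / hx * w₂ * (s₁ * f₂ * g₁ * v₂)) =
      f₁ / f₂ * u₁ * (r₁ * f₃ * g₂ * u₂) := by
    intro T₀ T₁ T₂ s₁ r₁ hx ha hb w₁ w₂ w₃ v₁ v₂ v₃ u₁ u₂ f₁ f₂ f₃ g₁ g₂ h1 h2 h3 h4 h5 h6 h7 h8 h9
    have hw : w₂ ≠ 0 := left_ne_zero_of_mul h7
    have hv : v₂ ≠ 0 := right_ne_zero_of_mul h7
    rw [div_eq_iff (by positivity)]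
    field_simp
    linear_combination (f₁ * g₂ * r₁ * f₃ * w₁ * v₁ * w₃ * v₃) * h8 +
      (f₁ * g₂ * r₁ * f₃) * h9
  rw [invertedDensity, e1, e2, e3]
  exact key _ _ _ _ _ _ _ _ _ _ _ _ _ _ _ _ _ _ _ _ _ hhx hha hhb hΦ hθ hsne hexpne hpow hexp

end Form

/-! ### From the abstract scaling to dilations of the cone -/

section Translation

variable {n : ℕ} {α : ℝ} {E : Set (EuclideanSpace ℝ (Fin n))}
  {p : ℝ → EuclideanSpace ℝ (Fin n) → EuclideanSpace ℝ (Fin n) → ℝ}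

/-- A differentiable derivative is continuous. Continuous differentiability is all the regularity
used. -/
theorem TwiceDifferentiableOn.contDiffOn_one {W : Type*} [NormedAddCommGroup W] [NormedSpace ℝ W]
    {f : W → ℝ} {U : Set W} (h : TwiceDifferentiableOn f U) (hU : IsOpen U) :
    ContDiffOn ℝ 1 f U := by
  have := (contDiffOn_succ_iff_fderiv_of_isOpen (𝕜 := ℝ) (n := 0) (f := f) hU).2
    ⟨h.1, by simp, contDiffOn_zero.2 h.2.continuousOn⟩
  simpa using this

/-- The scaling `x ↦ t ^ α • x` of a cone, extended by the identity to `t ≤ 0`. -/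
noncomputable def coneScaling (α : ℝ) (hcone : ∀ c : ℝ, 0 < c → ∀ x ∈ E, c • x ∈ E)
    (t : ℝ) (x : E) : E :=
  if ht : 0 < t then ⟨t ^ α • (x : EuclideanSpace ℝ (Fin n)), hcone _ (by positivity) _ x.2⟩ else x

variable {hcone : ∀ c : ℝ, 0 < c → ∀ x ∈ E, c • x ∈ E}

theorem coe_coneScaling {t : ℝ} (ht : 0 < t) (x : E) :
    (coneScaling α hcone t x : EuclideanSpace ℝ (Fin n)) = t ^ α • (x : EuclideanSpace ℝ (Fin n)) := by
  rw [coneScaling, dif_pos ht]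

theorem isScaling_coneScaling : IsScaling (coneScaling α hcone) := by
  refine ⟨fun x => ?_, fun s t hs ht x => ?_, ?_⟩
  · ext1
    rw [coe_coneScaling one_pos, Real.one_rpow, one_smul]
  · ext1
    rw [coe_coneScaling hs, coe_coneScaling ht, coe_coneScaling (mul_pos hs ht), smul_smul,
      Real.mul_rpow hs.le ht.le]
  · rw [Topology.IsInducing.subtypeVal.continuousOn_iff]
    have h : ContinuousOn (fun z : ℝ × E => z.1 ^ α • (z.2 : EuclideanSpace ℝ (Fin n)))
        (Ioi 0 ×ˢ univ) :=
      (continuousOn_fst.rpow_const fun z hz => Or.inl (ne_of_gt hz.1)).smul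
        (by fun_prop)
    exact h.congr fun z hz => coe_coneScaling hz.1 z.2

/-- The logarithm of the density of the inverted process at time `t`, up to the Jacobian. -/
noncomputable def logDensity (α : ℝ)
    (p : ℝ → EuclideanSpace ℝ (Fin n) → EuclideanSpace ℝ (Fin n) → ℝ) (t : ℝ) (x b : E) : ℝ :=
  Real.log (p (1 / t) x ((t ^ α)⁻¹ • (b : EuclideanSpace ℝ (Fin n))))

/-- With `s = t - r`, the elapsed time `1 / s - 1 / t` is the inverse of `τ = s * t / r`, and `S τ⁻¹
(S (t / r) a) = S s⁻¹ a`; this explains the arguments in `inversionExponent`. -/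
theorem inversionExponent_logDensity (hsg : IsSemigroupDensity E p) (x a b : E) {r t : ℝ}
    (hr : 0 < r) (hrt : r < t) :
    inversionExponent (coneScaling α hcone) (n * α) (logDensity α p) x a b r t =
      Real.log (invertedDensity α p x (t - r) t a b) := by
  have ht : 0 < t := hr.trans hrt
  have hs : 0 < t - r := sub_pos.2 hrt
  have hs' : 0 < ((t - r) ^ α)⁻¹ := by positivity
  have ht' : 0 < (t ^ α)⁻¹ := by positivity
  have h1 := hsg.pos (1 / t) (one_div_pos.2 ht) x x.2 _ (hcone _ ht' _ b.2)
  have h2 := hsg.pos _ (one_div_sub_pos hs (show t - r < t by linarith)) _ (hcone _ ht' _ b.2) _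
    (hcone _ hs' _ a.2)
  have h3 := hsg.pos (1 / (t - r)) (one_div_pos.2 hs) x x.2 _ (hcone _ hs' _ a.2)
  have htp : 0 < t ^ (-(n * α)) := by positivity
  have e1 : 1 / ((t - r) * t / r) = 1 / (t - r) - 1 / t := by
    field_simp
    ring
  have e2 : (((t - r) * t / r) ^ α)⁻¹ • (t / r) ^ α • (a : EuclideanSpace ℝ (Fin n)) =
      ((t - r) ^ α)⁻¹ • (a : EuclideanSpace ℝ (Fin n)) := by
    rw [smul_smul, mul_div_assoc, Real.mul_rpow hs.le (by positivity)]
    congr 1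
    field_simp
  rw [invertedDensity, Real.log_div (by positivity) h3.ne', Real.log_mul htp.ne' (by positivity),
    Real.log_mul h1.ne' h2.ne', Real.log_rpow ht]
  simp only [inversionExponent, logDensity]
  rw [coe_coneScaling (inv_pos.2 ht), coe_coneScaling (div_pos ht hr), e1, e2,
    Real.inv_rpow ht.le]
  ring

theorem continuousOn_logDensity (hsg : IsSemigroupDensity E p)
    (hcone : ∀ c : ℝ, 0 < c → ∀ x ∈ E, c • x ∈ E)
    (hp : ContinuousOn (fun z : ℝ × EuclideanSpace ℝ (Fin n) × EuclideanSpace ℝ (Fin n) =>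
      p z.1 z.2.1 z.2.2) (Ioi 0 ×ˢ E ×ˢ E)) :
    ContinuousOn (fun z : ℝ × E × E => logDensity α p z.1 z.2.1 z.2.2) (Ioi 0 ×ˢ univ) := by
  have hmem : ∀ z : ℝ × E × E, z ∈ Ioi (0 : ℝ) ×ˢ (univ : Set (E × E)) →
      (z.1 ^ α)⁻¹ • (z.2.2 : EuclideanSpace ℝ (Fin n)) ∈ E := fun z hz =>
    hcone _ (inv_pos.2 (Real.rpow_pos_of_pos hz.1 _)) _ z.2.2.2
  refine ContinuousOn.log (hp.comp (f := fun z : ℝ × E × E => (1 / z.1,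
    (z.2.1 : EuclideanSpace ℝ (Fin n)), (z.1 ^ α)⁻¹ • (z.2.2 : EuclideanSpace ℝ (Fin n)))) ?_
    fun z hz => ⟨mem_Ioi.2 (one_div_pos.2 hz.1), z.2.1.2, hmem z hz⟩) fun z hz =>
    (hsg.pos _ (one_div_pos.2 hz.1) _ z.2.1.2 _ (hmem z hz)).ne'
  have h1 : ContinuousOn (fun z : ℝ × E × E => 1 / z.1) (Ioi 0 ×ˢ univ) :=
    continuousOn_const.div continuousOn_fst fun z hz => ne_of_gt hz.1
  have h2 : ContinuousOn (fun z : ℝ × E × E => (z.1 ^ α)⁻¹) (Ioi 0 ×ˢ univ) :=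
    (continuousOn_fst.rpow_const fun z hz => Or.inl (ne_of_gt hz.1)).inv₀
      fun z hz => (Real.rpow_pos_of_pos hz.1 _).ne'
  have h3 : Continuous fun z : ℝ × E × E => (z.2.1 : EuclideanSpace ℝ (Fin n)) := by fun_prop
  have h4 : Continuous fun z : ℝ × E × E => (z.2.2 : EuclideanSpace ℝ (Fin n)) := by fun_prop
  exact h1.prodMk (h3.continuousOn.prodMk (h2.smul h4.continuousOn))

theorem contDiff_logDensity (hsg : IsSemigroupDensity E p)
    (hp : ContDiffOn ℝ 1 (fun z : ℝ × EuclideanSpace ℝ (Fin n) × EuclideanSpace ℝ (Fin n) =>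
      p z.1 z.2.1 z.2.2) (Ioi 0 ×ˢ E ×ˢ E)) (x : E) {t : ℝ} (ht : 0 < t) :
    ContDiff ℝ 1 fun z : ℝ × ℝ => logDensity α p t (coneScaling α hcone (Real.exp z.1) x)
      (coneScaling α hcone (Real.exp z.2) x) := by
  have ht' : 0 < (t ^ α)⁻¹ := by positivity
  have e : (fun z : ℝ × ℝ => logDensity α p t (coneScaling α hcone (Real.exp z.1) x)
      (coneScaling α hcone (Real.exp z.2) x)) = fun z : ℝ × ℝ => Real.log (p (1 / t)
        (Real.exp (z.1 * α) • (x : EuclideanSpace ℝ (Fin n)))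
        ((t ^ α)⁻¹ • Real.exp (z.2 * α) • (x : EuclideanSpace ℝ (Fin n)))) := by
    funext z
    rw [logDensity, coe_coneScaling (Real.exp_pos _), coe_coneScaling (Real.exp_pos _),
      Real.exp_mul, Real.exp_mul]
  have hmem : ∀ z : ℝ × ℝ, (1 / t, Real.exp (z.1 * α) • (x : EuclideanSpace ℝ (Fin n)),
      (t ^ α)⁻¹ • Real.exp (z.2 * α) • (x : EuclideanSpace ℝ (Fin n))) ∈
      Ioi (0 : ℝ) ×ˢ E ×ˢ E := fun z =>
    ⟨one_div_pos.2 ht, hcone _ (Real.exp_pos _) _ x.2,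
      hcone _ ht' _ (hcone _ (Real.exp_pos _) _ x.2)⟩
  rw [e]
  refine ContDiff.log (hp.comp_contDiff (f := fun z : ℝ × ℝ => (1 / t,
    Real.exp (z.1 * α) • (x : EuclideanSpace ℝ (Fin n)),
    (t ^ α)⁻¹ • Real.exp (z.2 * α) • (x : EuclideanSpace ℝ (Fin n)))) ?_ hmem) fun z =>
    (hsg.pos _ (hmem z).1 _ (hmem z).2.1 _ (hmem z).2.2).ne'
  fun_prop

/-- Either the origin lies in `E` and is fixed by all dilations, or the norm is positive on `E` and
its power `1 / α` has degree one under `coneScaling`. -/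
theorem exists_base_point (hα : 0 < α) (hne : E.Nonempty) :
    ∃ x₀ : E, (∀ t, 0 < t → coneScaling α hcone t x₀ = x₀) ∨
      ∃ σ : E → ℝ, Continuous σ ∧ (∀ x, 0 < σ x) ∧
        ∀ t, 0 < t → ∀ x, σ (coneScaling α hcone t x) = t * σ x := by
  by_cases h0 : (0 : EuclideanSpace ℝ (Fin n)) ∈ E
  · refine ⟨⟨0, h0⟩, Or.inl fun t ht => ?_⟩
    ext1
    rw [coe_coneScaling ht, smul_zero]
  · obtain ⟨x₀, hx₀⟩ := hne
    refine ⟨⟨x₀, hx₀⟩, Or.inr ⟨fun x => ‖(x : EuclideanSpace ℝ (Fin n))‖ ^ (1 / α), ?_, ?_, ?_⟩⟩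
    · exact (continuous_subtype_val.norm).rpow_const fun x => Or.inr (by positivity)
    · intro x
      refine Real.rpow_pos_of_pos (norm_pos_iff.2 fun h => h0 ?_) _
      rw [← h]
      exact x.2
    · intro t ht x
      simp only [coe_coneScaling ht]
      rw [norm_smul, Real.norm_of_nonneg (by positivity),
        Real.mul_rpow (by positivity) (norm_nonneg _), ← Real.rpow_mul ht.le,
        mul_one_div_cancel hα.ne', Real.rpow_one]

/-- The densities have the inversion form up to an `h`-transform as soon as the transition
densities of the inverted process are homogeneous in time. -/
theorem exists_hasInversionForm (hα : 0 < α) (hE : IsOpen E)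
    (hcone : ∀ c : ℝ, 0 < c → ∀ x ∈ E, c • x ∈ E) (hsg : IsSemigroupDensity E p)
    (hp : ContDiffOn ℝ 1 (fun z : ℝ × EuclideanSpace ℝ (Fin n) × EuclideanSpace ℝ (Fin n) =>
      p z.1 z.2.1 z.2.2) (Ioi 0 ×ˢ E ×ˢ E))
    (hinv : ∀ x ∈ E, ∀ a ∈ E, ∀ b ∈ E, ∀ r t t', 0 < r → r < t → r < t' →
      invertedDensity α p x (t - r) t a b = invertedDensity α p x (t' - r) t' a b) :
    ∃ (Φ : EuclideanSpace ℝ (Fin n) → EuclideanSpace ℝ (Fin n) → ℝ)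
      (θ ρ : EuclideanSpace ℝ (Fin n) → ℝ)
      (p₀ : ℝ → EuclideanSpace ℝ (Fin n) → EuclideanSpace ℝ (Fin n) → ℝ)
      (h : EuclideanSpace ℝ (Fin n) → ℝ) (ν : ℝ),
      HasInversionForm E α Φ θ ρ p₀ ∧ IsHTransform E h ν p₀ p := by
  classical
  rcases E.eq_empty_or_nonempty with rfl | hne
  · exact ⟨0, 0, 0, 0, 1, 0, ⟨by simp, by simp, ⟨0, by simp⟩, by simp⟩,
      ⟨measurable_const, by simp, by simp⟩⟩
  obtain ⟨x₀, hx₀⟩ := exists_base_point (hcone := hcone) hα hne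
  obtain ⟨φ, ρ, T, H, β, ν, hφ, hρ, hT, hH, hform⟩ := exists_inversion_form
    (isScaling_coneScaling (α := α) (hcone := hcone)) (N := n * α)
    (continuousOn_logDensity (α := α) hsg hcone hp.continuousOn)
    (fun x a b r t t' hr ht ht' => by
      rw [inversionExponent_logDensity hsg x a b hr ht,
        inversionExponent_logDensity hsg x a b hr ht',
        hinv x x.2 a a.2 b b.2 r t t' hr ht ht']) x₀
    (fun t ht => contDiff_logDensity hsg hp x₀ ht) hx₀
  -- a general scaling factor `c` is the scaling by `c ^ (1 / α)`
  have hsc : ∀ c (hc : 0 < c) x (hx : x ∈ E), (⟨c • x, hcone c hc x hx⟩ : E) =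
      coneScaling α hcone (c ^ (1 / α)) ⟨x, hx⟩ := by
    intro c hc x hx
    ext1
    rw [coe_coneScaling (by positivity), ← Real.rpow_mul hc.le, one_div_mul_cancel hα.ne',
      Real.rpow_one]
  set Φ' : EuclideanSpace ℝ (Fin n) → EuclideanSpace ℝ (Fin n) → ℝ := fun x y =>
    if h : x ∈ E ∧ y ∈ E then Real.exp (φ ⟨x, h.1⟩ ⟨y, h.2⟩) else 0 with hΦ'
  set θ' : EuclideanSpace ℝ (Fin n) → ℝ := fun y =>
    if h : y ∈ E then Real.exp (T ⟨y, h⟩) else 0 with hθ'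
  set ρ' : EuclideanSpace ℝ (Fin n) → ℝ := fun x => if h : x ∈ E then ρ ⟨x, h⟩ else 0 with hρ'
  set h' : EuclideanSpace ℝ (Fin n) → ℝ := fun x =>
    if h : x ∈ E then Real.exp (H ⟨x, h⟩) else 1 with hh'
  have eΦ : ∀ x (hx : x ∈ E) y (hy : y ∈ E), Φ' x y = Real.exp (φ ⟨x, hx⟩ ⟨y, hy⟩) :=
    fun x hx y hy => dif_pos ⟨hx, hy⟩
  have eθ : ∀ y (hy : y ∈ E), θ' y = Real.exp (T ⟨y, hy⟩) := fun y hy => dif_pos hy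
  have eρ : ∀ y (hy : y ∈ E), ρ' y = ρ ⟨y, hy⟩ := fun y hy => dif_pos hy
  have eh : ∀ y (hy : y ∈ E), h' y = Real.exp (H ⟨y, hy⟩) := fun y hy => dif_pos hy
  -- The factor `c` is the scaling at time `c ^ (1 / α)`, which turns the degree `β` into `β / α`.
  have hβ : ∀ c : ℝ, 0 < c → ∀ y ∈ E, θ' (c • y) = c ^ (β / α) * θ' y := by
    intro c hc y hy
    rw [eθ _ (hcone c hc y hy), eθ y hy, hsc c hc y hy, hT _ (by positivity), Real.log_rpow hc,
      Real.exp_add, Real.rpow_def_of_pos hc, mul_comm]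
    congr 2
    ring
  have hf : HasInversionForm E α Φ' θ' ρ' (fun t x y => t ^ (-(n * α / 2)) *
      Φ' ((t ^ (α / 2))⁻¹ • x) ((t ^ (α / 2))⁻¹ • y) * θ' ((t ^ (α / 2))⁻¹ • y) *
      Real.exp (ρ' ((t ^ (α / 2))⁻¹ • x) + ρ' ((t ^ (α / 2))⁻¹ • y))) := by
    refine ⟨fun c hc x hx y hy => ?_, fun c hc x hx => ?_, ⟨β / α, hβ⟩,
      fun _ _ _ _ _ _ => rfl⟩
    · rw [eΦ _ (hcone c hc x hx) y hy, eΦ x hx _ (hcone c hc y hy), hsc c hc x hx,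
        hsc c hc y hy, hφ _ (by positivity)]
    · rw [eρ _ (hcone c hc x hx), eρ x hx, hsc c hc x hx, hρ _ (by positivity),
        ← Real.rpow_natCast, ← Real.rpow_mul hc.le]
      congr 2
      push_cast
      ring
  refine ⟨Φ', θ', ρ', _, h', ν, hf, ?_, fun x hx => ?_, fun t ht x hx y hy => ?_⟩
  · exact Measurable.dite (f := fun x : E => Real.exp (H x)) (g := fun _ => 1)
      (Real.continuous_exp.comp hH).measurable measurable_const hE.measurableSet
  · rw [eh x hx]
    exact Real.exp_pos _
  · have e := hform t⁻¹ (inv_pos.2 ht) ⟨x, hx⟩ ⟨y, hy⟩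
    have ht' : 0 < (t ^ α)⁻¹ := by positivity
    have eS : coneScaling α hcone t⁻¹ ⟨y, hy⟩ = ⟨(t ^ α)⁻¹ • y, hcone _ ht' y hy⟩ := by
      ext1
      rw [coe_coneScaling (inv_pos.2 ht), Real.inv_rpow ht.le]
    rw [logDensity, eS, one_div, inv_inv, Real.inv_rpow ht.le, inv_inv,
      smul_inv_smul₀ (by positivity), Real.log_inv] at e
    rw [hf.density_eq hα hcone hβ t ht x hx y hy, eh x hx, eh y hy,
      eΦ x hx _ (hcone _ ht' y hy), eθ y hy, eρ x hx, eρ y hy,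
      ← Real.exp_log (hsg.pos t ht x hx y hy), e,
      Real.rpow_def_of_pos ht (-((n + β / α) * α / 2)), ← Real.exp_sub]
    simp only [← Real.exp_add]
    congr 1
    field_simp
    ring

end Translation

end TimeInversion

/-! ### The characterisation and the semigroup of the inverted process -/

theorem theorem1 {n : ℕ} (α : ℝ) (hα : 0 < α)
    (E : Set (EuclideanSpace ℝ (Fin n))) (hE : IsOpen E)
    (hcone : ∀ c : ℝ, 0 < c → ∀ x ∈ E, c • x ∈ E)
    {Ω : Type*} [MeasurableSpace Ω]
    (X : ℝ → Ω → EuclideanSpace ℝ (Fin n))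
    (P : EuclideanSpace ℝ (Fin n) → MeasureTheory.Measure Ω)
    (p : ℝ → EuclideanSpace ℝ (Fin n) → EuclideanSpace ℝ (Fin n) → ℝ)
    (hX : TimeInversion.IsMarkovProcess E X P p)
    (hp : TimeInversion.TwiceDifferentiableOn
      (fun z : ℝ × EuclideanSpace ℝ (Fin n) × EuclideanSpace ℝ (Fin n) => p z.1 z.2.1 z.2.2)
      (Set.Ioi 0 ×ˢ E ×ˢ E)) :
    ((∀ x ∈ E, TimeInversion.IsHomogeneousMarkov (Set.Ioi 0)
        (TimeInversion.timeInverted α X) (P x)) ↔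
      ∃ (Φ : EuclideanSpace ℝ (Fin n) → EuclideanSpace ℝ (Fin n) → ℝ)
        (θ ρ : EuclideanSpace ℝ (Fin n) → ℝ)
        (p₀ : ℝ → EuclideanSpace ℝ (Fin n) → EuclideanSpace ℝ (Fin n) → ℝ)
        (h : EuclideanSpace ℝ (Fin n) → ℝ) (ν : ℝ),
        TimeInversion.HasInversionForm E α Φ θ ρ p₀ ∧ TimeInversion.IsHTransform E h ν p₀ p) ∧
    (∀ (Φ : EuclideanSpace ℝ (Fin n) → EuclideanSpace ℝ (Fin n) → ℝ)
        (θ ρ : EuclideanSpace ℝ (Fin n) → ℝ)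
        (p₀ : ℝ → EuclideanSpace ℝ (Fin n) → EuclideanSpace ℝ (Fin n) → ℝ)
        (h : EuclideanSpace ℝ (Fin n) → ℝ) (ν : ℝ),
        TimeInversion.HasInversionForm E α Φ θ ρ p₀ → TimeInversion.IsHTransform E h ν p₀ p →
        (∀ x ∈ E, ∀ y ∈ E, Φ x y = Φ y x) →
        ∀ x ∈ E, ∃ q : ℝ → EuclideanSpace ℝ (Fin n) → EuclideanSpace ℝ (Fin n) → ℝ,
          (∀ t, 0 < t → ∀ a ∈ E, ∀ b ∈ E,
            q t a b = Φ x b / Φ x a * Real.exp (t * ρ x) * p₀ t a b) ∧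
          (∀ s t, 0 < s → s < t → ∀ a ∈ E, ∀ b ∈ E,
            TimeInversion.invertedDensity α p x s t a b = q (t - s) a b) ∧
          TimeInversion.IsSemigroupDensity E q ∧
          TimeInversion.IsMarkovWith (Set.Ioi 0) (TimeInversion.timeInverted α X) (P x)
            (TimeInversion.densityMeasure E q)) := by
  have hEm := hE.measurableSet
  have hsg := hX.semigroup
  have hC1 := hp.contDiffOn_one (isOpen_Ioi.prod (hE.prod hE))
  have hcont := hC1.continuousOn
  have hm : ∀ t, 0 < t → Measurable (Function.uncurry (TimeInversion.eDensity E p t)) :=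
    fun t ht => TimeInversion.measurable_eDensity hE (TimeInversion.continuousOn_density hcont ht)
  refine ⟨⟨fun hH => ?_, ?_⟩, ?_⟩
  · refine TimeInversion.exists_hasInversionForm hα hE hcone hsg hC1 ?_
    intro x hx a ha b hb r t t' hr ht ht'
    exact TimeInversion.invertedDensity_eq_of_isHomogeneousMarkov hE hX hcont hcone hx (hH x hx)
      (by linarith) (by linarith) (by linarith) (by linarith) (by ring) ha hb
  · rintro ⟨Φ, θ, ρ, p₀, h, ν, hf, hh⟩ x hx
    obtain ⟨β, hβ⟩ := hf.theta_homogeneous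
    have hq := fun s t hs hst a ha b hb => TimeInversion.invertedDensity_eq_of_form
      (s := s) (t := t) (a := a) (b := b) hα hsg hcone hf hh hβ hx hs hst ha hb
    exact hX.isHomogeneousMarkov_timeInverted (q := fun r a b => Φ x b / Φ x a *
        Real.exp (r * ρ x) * (r ^ (-((n + β) * α / 2)) * Φ b ((r ^ α)⁻¹ • a) * θ b *
        Real.exp ((ρ a + ρ b) / r))) hEm hm hcone hx hq
      fun t ht => TimeInversion.measurable_eDensity_of_invertedDensity hE hsg hcont hcone hx hq ht
  · intro Φ θ ρ p₀ h ν hf hh hsymm x hx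
    obtain ⟨β, hβ⟩ := hf.theta_homogeneous
    -- Symmetry of `Φ` restores the order of its arguments and turns the homogeneous density into
    -- the stated multiple of `p₀`.
    have hq : ∀ s t, 0 < s → s < t → ∀ a ∈ E, ∀ b ∈ E,
        TimeInversion.invertedDensity α p x s t a b =
          Φ x b / Φ x a * Real.exp ((t - s) * ρ x) * p₀ (t - s) a b := by
      intro s t hs hst a ha b hb
      have hr : 0 < ((t - s) ^ α)⁻¹ := inv_pos.2 (Real.rpow_pos_of_pos (sub_pos.2 hst) _)
      rw [TimeInversion.invertedDensity_eq_of_form hα hsg hcone hf hh hβ hx hs hst ha hb,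
        hf.density_eq hα hcone hβ _ (sub_pos.2 hst) a ha b hb,
        ← hf.kernel_scaling _ hr b hb a ha, hsymm _ (hcone _ hr b hb) a ha]
    exact ⟨fun t a b => Φ x b / Φ x a * Real.exp (t * ρ x) * p₀ t a b,
      fun _ _ _ _ _ _ => rfl, hq,
      TimeInversion.isSemigroupDensity_of_invertedDensity hsg hEm hm hcone hx hq,
      hX.isMarkovWith_timeInverted hEm hm hcone hx hq⟩
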